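/- All graphs are finite and simple. A good edge-labeling of a graph is a map $\phi$ from its edges to $\mathbb R$ such that for every ordered pair of vertices $(u,v)$ there is at most one path from $u$ to $v$ along which the labels are nondecreasing. A graph is critical if it has no good edge-labeling but each of its proper subgraphs has one. Let $G$ be a critical graph of girth at least $5$; $d(v)$ denotes the degree of $v$ in $G$. An internally shortest 3-path is a path $x_0x_1\dots x_\ell$ in $G$ with $\ell\ge 1$ and $d(x_j)=3$ for $1\le j\le \ell-1$, such that $x_1\dots x_\ell$ is a shortest $x_1$–$x_\ell$ path in $G-x_0x_1$. A sail with tip $x_0x_1$ is an internally shortest 3-path $x_0x_1\dots x_\ell$ with $d(x_0)=2$ and $d(x_\ell)\ge 4$ whose length $\ell$ is minimum among all such paths that begin with $x_0x_1$. For an integer $k\ge 3$ and a vertex $y$ with $d(y)\in\{\max(4,k),\,k+1\}$, a $k$-windmill with axis $y$ is the subgraph of $G$ induced by the union of the vertex sets of $k$ sails that have pairwise distinct tips and all end in $y$. A flag of a windmill $W$ is a vertex outside $W$ with at least two neighbours in $W$, and the closure $\overline W$ of $W$ is the subgraph of $G$ induced by the vertices of $W$ and all flags of $W$. A wheel is a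 graph with vertex types in $\{0,1,2\}$ that consists of an oriented cycle and a center, not on the cycle, adjacent to $k\ge 2$ vertices of the cycle, the anchors, any two of which are at distance at least $3$ on the cycle; anchors have type $0$, their successors type $2$, the successors of these type $0$, all other vertices of the cycle type $1$, and the center has type $0$ or $1$. The wheel is evil (respectively almost evil) if every anchor is followed by the next anchor after exactly three steps along the cycle and the center has type $1$ (respectively type $0$). Theorem. For every windmill $W$ in $G$, the closure $\overline W$ contains an induced subgraph that, for some choice of vertex types (that is, disregarding types), is an evil or an almost evil wheel. -/

import Mathlib

namespace GoodLabel

variable {V : Type*}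

/-! ### Good edge-labelings and critical graphs -/

/-- The labels of the edges along the walk `p` are nondecreasing. -/
def Nondecreasing {G : SimpleGraph V} (φ : Sym2 V → ℝ) {u v : V} (p : G.Walk u v) : Prop :=
  (p.edges.map φ).IsChain (· ≤ ·)

/-- `φ` (only its values on edges of `G` matter) is a good edge-labeling of `G`: for every ordered
pair `(u, v)` there is at most one nondecreasing path from `u` to `v`. -/
def IsGoodLabeling (G : SimpleGraph V) (φ : Sym2 V → ℝ) : Prop :=
  ∀ (u v : V) (p q : G.Walk u v), p.IsPath → q.IsPath →
    Nondecreasing φ p → Nondecreasing φ q → p = q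

/-- `G` has a good edge-labeling. -/
def HasGoodLabeling (G : SimpleGraph V) : Prop :=
  ∃ φ : Sym2 V → ℝ, IsGoodLabeling G φ

/-- `G` is critical: it has no good edge-labeling, but every proper subgraph has one. -/
def IsCritical (G : SimpleGraph V) : Prop :=
  ¬ HasGoodLabeling G ∧ ∀ H : G.Subgraph, H ≠ ⊤ → HasGoodLabeling H.coe

/-! ### Sails, windmills, flags, closures -/

section Windmills

variable [Fintype V] (G : SimpleGraph V) [DecidableRel G.Adj]

/-- `p = x₀ x₁ … x_ℓ` is an internally shortest 3-path: a path of length `ℓ ≥ 1` whose interior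
vertices have degree 3 and such that, with `e = x₀x₁`, the path `x₁ … x_ℓ` is a shortest path
between its ends in `G - e`. (Here `x₁ = p.snd`; as `p` is a path, `p.tail` avoids `e`.) -/
structure IsInternallyShortest3Path {x y : V} (p : G.Walk x y) : Prop where
  isPath : p.IsPath
  one_le_length : 1 ≤ p.length
  degree_interior : ∀ v ∈ p.support, v ≠ x → v ≠ y → G.degree v = 3
  shortest : p.tail.length = (G.deleteEdges {s(x, p.snd)}).dist p.snd y

/-- `p` is a sail with tip `x₀x₁ = s(x, p.snd)`: it is an internally shortest 3-path from a
2-vertex to a `4⁺`-vertex, of minimum length among all those with the same tip. -/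
structure IsSail {x y : V} (p : G.Walk x y) : Prop where
  internallyShortest : IsInternallyShortest3Path G p
  degree_start : G.degree x = 2
  degree_end : 4 ≤ G.degree y
  minimal : ∀ (y' : V) (p' : G.Walk x y'), IsInternallyShortest3Path G p' →
    4 ≤ G.degree y' → p'.snd = p.snd → p.length ≤ p'.length

/-- The induced subgraph of `G` on the vertex set `W` is a `k`-windmill with axis `y`. -/
def IsWindmill (k : ℕ) (y : V) (W : Set V) : Prop :=
  3 ≤ k ∧ (G.degree y = max 4 k ∨ G.degree y = k + 1) ∧
    ∃ (x : Fin k → V) (P : ∀ i, G.Walk (x i) y),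
      (∀ i, IsSail G (P i)) ∧
      Function.Injective (fun i => s(x i, (P i).snd)) ∧
      W = {v | ∃ i, v ∈ (P i).support}

end Windmills

/-- `w` is a flag of `W`: a vertex outside `W` with at least two neighbours in `W`. -/
def IsFlag (G : SimpleGraph V) (W : Set V) (w : V) : Prop :=
  w ∉ W ∧ ∃ a ∈ W, ∃ b ∈ W, a ≠ b ∧ G.Adj w a ∧ G.Adj w b

/-- The vertex set of the closure of `W`, which is the subgraph of `G` induced by the vertices
of `W` and all flags of `W`. -/
def closureVerts (G : SimpleGraph V) (W : Set V) : Set V :=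
  W ∪ {w | IsFlag G W w}

/-! ### Wheels -/

/-- The graph `H` with types `τ` is a wheel with centre `c`, rim the cycle `r 0, r 1, …, r (n-1)`
oriented by `i ↦ i + 1`, and anchors the rim vertices `r i` with `i ∈ A`. -/
structure IsWheel (H : SimpleGraph V) (τ : V → Fin 3) (n : ℕ) (c : V) (r : ZMod n → V)
    (A : Set (ZMod n)) : Prop where
  three_le : 3 ≤ n
  rim_injective : Function.Injective r
  center_not_rim : ∀ i, r i ≠ c
  cover : ∀ v, v = c ∨ ∃ i, v = r i
  adj_rim : ∀ i j, H.Adj (r i) (r j) ↔ j = i + 1 ∨ i = j + 1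
  adj_center : ∀ i, H.Adj c (r i) ↔ i ∈ A
  two_le_anchors : 2 ≤ A.ncard
  /-- any two anchors have distance at least three on the cycle -/
  anchors_far : ∀ i ∈ A, i + 1 ∉ A ∧ i + 2 ∉ A
  type_anchor : ∀ i ∈ A, τ (r i) = 0
  type_bogey : ∀ i ∈ A, τ (r (i + 1)) = 2
  type_spectator : ∀ i ∈ A, τ (r (i + 2)) = 0
  type_booby : ∀ i, i ∉ A → i - 1 ∉ A → i - 2 ∉ A → τ (r i) = 1
  type_center : τ c = 0 ∨ τ c = 1

/-- An evil wheel: consecutive anchors are always at distance exactly three, and the centre has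
type 1. -/
def IsEvilWheel (H : SimpleGraph V) (τ : V → Fin 3) : Prop :=
  ∃ (n : ℕ) (c : V) (r : ZMod n → V) (A : Set (ZMod n)),
    IsWheel H τ n c r A ∧ (∀ i ∈ A, i + 3 ∈ A) ∧ τ c = 1

/-- An almost evil wheel: consecutive anchors are always at distance exactly three, and the centre
has type 0. -/
def IsAlmostEvilWheel (H : SimpleGraph V) (τ : V → Fin 3) : Prop :=
  ∃ (n : ℕ) (c : V) (r : ZMod n → V) (A : Set (ZMod n)),
    IsWheel H τ n c r A ∧ (∀ i ∈ A, i + 3 ∈ A) ∧ τ c = 0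

end GoodLabel

namespace GoodLabel
open SimpleGraph

variable {V : Type*} {G : SimpleGraph V}

/-! ### Nondecreasing walks -/

/-! The proof tests criticality by labeling a small part of `G` by hand. Suppose every vertex of a
set `S` has at most one edge outside a set `T` of edges inside `S`. Label `T` by hand, take a good
labeling of `G - S`, and give all other edges at `S` one very large label. By
`not_isCritical_of_layer` the result is good, provided the labeling of `T` is good and no vertex
reaches two mates by nondecreasing paths in `T`.

This is applied to spiders: legs running from tips to a common axis. Each leg `i` has a basic value
`E i`. The first edge of a low leg gets the least label, and one edge near the tip of a long leg
gets the greatest label, which stops nondecreasing paths. What remains is a system of inequalities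
`E j < E i`, the arcs. It is solvable if the arcs are acyclic, so in a critical graph they contain a
directed cycle (`Spider.exists_transGen_arc`).

Spiders with at most two legs restrict paths and cycles through vertices of degree two. Hence
vertices close to a sail have degree three (`SailSeq.degree_of_reach`) and two sails with common
axis stay apart (`SailSeq.not_reach`). The sails of a windmill therefore form a spider themselves.
Its directed cycle of arcs passes only through legs of length two, consecutive legs being linked by
flags. These legs and flags form a rim around the axis, and this is the wheel; if two of the flags
are adjacent, a smaller wheel with a six-cycle as rim is used instead (`containsWheel_of_chord`). -/

theorem nondecreasing_iff {φ : Sym2 V → ℝ} {u v : V} {p : G.Walk u v} :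
    Nondecreasing φ p ↔ (p.edges.map φ).Pairwise (· ≤ ·) :=
  List.isChain_iff_pairwise

theorem nondecreasing_cons {φ : Sym2 V → ℝ} {u v w : V} {h : G.Adj u v} {p : G.Walk v w} :
    Nondecreasing φ (Walk.cons h p) ↔
      (∀ e ∈ p.edges, φ s(u, v) ≤ φ e) ∧ Nondecreasing φ p := by
  simp [nondecreasing_iff]

theorem nondecreasing_concat {φ : Sym2 V → ℝ} {u v w : V} {p : G.Walk u v} {h : G.Adj v w} :
    Nondecreasing φ (p.concat h) ↔
      (∀ e ∈ p.edges, φ e ≤ φ s(v, w)) ∧ Nondecreasing φ p := by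
  simp only [nondecreasing_iff, Walk.edges_concat, List.concat_eq_append, List.map_append,
    List.pairwise_append]
  simp only [List.map_cons, List.map_nil, List.pairwise_singleton, List.mem_map, true_and,
    List.mem_singleton, forall_eq, forall_exists_index, and_imp, forall_apply_eq_imp_iff₂]
  exact and_comm

theorem Nondecreasing.congr {φ ψ : Sym2 V → ℝ} {u v : V} {p : G.Walk u v}
    (h : Nondecreasing φ p) (heq : ∀ e ∈ p.edges, φ e = ψ e) : Nondecreasing ψ p := by
  unfold Nondecreasing at *
  rwa [← List.map_congr_left heq]

/-- `p` is a path using only edges from `E`, along which the labels are nondecreasing. -/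
structure MonoPath (φ : Sym2 V → ℝ) (E : Set (Sym2 V)) {u v : V} (p : G.Walk u v) : Prop where
  isPath : p.IsPath
  edges_mem : ∀ e ∈ p.edges, e ∈ E
  mono : Nondecreasing φ p

theorem MonoPath.of_cons {φ : Sym2 V → ℝ} {E : Set (Sym2 V)} {u v w : V} {h : G.Adj u v}
    {p : G.Walk v w} (hp : MonoPath φ E (Walk.cons h p)) : MonoPath φ E p :=
  ⟨hp.isPath.of_cons, fun e he => hp.edges_mem e (by simp [he]),
    (nondecreasing_cons.1 hp.mono).2⟩

theorem MonoPath.notMem {φ : Sym2 V → ℝ} {E : Set (Sym2 V)} {u v w : V} {h : G.Adj u v}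
    {p : G.Walk v w} (hp : MonoPath φ E (Walk.cons h p)) : u ∉ p.support :=
  ((Walk.cons_isPath_iff h p).1 hp.isPath).2

theorem MonoPath.head_mem {φ : Sym2 V → ℝ} {E : Set (Sym2 V)} {u v w : V} {h : G.Adj u v}
    {p : G.Walk v w} (hp : MonoPath φ E (Walk.cons h p)) : s(u, v) ∈ E :=
  hp.edges_mem _ (by simp)

theorem MonoPath.head_le {φ : Sym2 V → ℝ} {E : Set (Sym2 V)} {u v w : V} {h : G.Adj u v}
    {p : G.Walk v w} (hp : MonoPath φ E (Walk.cons h p)) : ∀ e ∈ p.edges, φ s(u, v) ≤ φ e :=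
  (nondecreasing_cons.1 hp.mono).1

/-- `φ` is a good labeling of the graph with edge set `E`. -/
def GoodOn (G : SimpleGraph V) (φ : Sym2 V → ℝ) (E : Set (Sym2 V)) : Prop :=
  ∀ (u v : V) (p q : G.Walk u v), MonoPath φ E p → MonoPath φ E q → p = q

/-! ### Extending a labeling of a subgraph of a critical graph -/

/-- `s` and `t` are joined by an edge not in `T`, or have a common neighbour outside `S`. -/
def Mates (G : SimpleGraph V) (S : Set V) (T : Set (Sym2 V)) (s t : V) : Prop :=
  s ≠ t ∧ ((G.Adj s t ∧ s(s, t) ∉ T) ∨ ∃ f ∉ S, G.Adj f s ∧ G.Adj f t)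

theorem Mates.symm {S : Set V} {T : Set (Sym2 V)} {s t : V} (h : Mates G S T s t) :
    Mates G S T t s := by
  obtain ⟨hne, h | ⟨f, hf, h1, h2⟩⟩ := h
  · exact ⟨hne.symm, Or.inl ⟨h.1.symm, by rw [Sym2.eq_swap]; exact h.2⟩⟩
  · exact ⟨hne.symm, Or.inr ⟨f, hf, h2, h1⟩⟩

/-- Extending the labels by 0 to pairs that meet `S` turns a labeling of the induced subgraph into a
function on all of `Sym2 V`, ready to be glued with labels at `S`. -/
theorem HasGoodLabeling.exists_on_compl {S : Set V}
    (h : HasGoodLabeling ((⊤ : G.Subgraph).induce Sᶜ).coe) :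
    ∃ ψ : Sym2 V → ℝ, ∀ (u v : V) (p q : G.Walk u v), p.IsPath → q.IsPath →
      (∀ x ∈ p.support, x ∉ S) → (∀ x ∈ q.support, x ∉ S) →
      Nondecreasing ψ p → Nondecreasing ψ q → p = q := by
  classical
  obtain ⟨φ, hφ⟩ := h
  let ι : ↥(Sᶜ : Set V) → V := Subtype.val
  have hι : Function.Injective (Sym2.map ι) := Sym2.map.injective Subtype.val_injective
  let ψ : Sym2 V → ℝ := fun e => if h : ∃ e', Sym2.map ι e' = e then φ h.choose else 0
  have hψ : ∀ e, ψ (Sym2.map ι e) = φ e := fun e => by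
    have h : ∃ e', Sym2.map ι e' = Sym2.map ι e := ⟨e, rfl⟩
    simp only [ψ, dif_pos h]
    rw [hι h.choose_spec]
  have key : ∀ {u v : V} (p : G.Walk u v) (hp : ∀ x ∈ p.support, x ∈ Sᶜ), Nondecreasing ψ p →
      Nondecreasing (G := G.induce Sᶜ) φ (p.induce Sᶜ hp) := by
    intro u v p hp hn
    have he : p.edges = (p.induce Sᶜ hp).edges.map (Sym2.map ι) :=
      (congrArg Walk.edges (Walk.map_induce p hp)).symm.trans (Walk.edges_map _ _)
    unfold Nondecreasing at hn ⊢
    rw [he, List.map_map] at hn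
    convert hn using 2
    exact List.map_congr_left fun e _ => (hψ e).symm
  have hpath : ∀ {u v : V} (p : G.Walk u v) (hp : ∀ x ∈ p.support, x ∈ Sᶜ), p.IsPath →
      (p.induce Sᶜ hp).IsPath := by
    intro u v p hp h
    rw [← Walk.map_induce p hp] at h
    exact h.of_map
  rw [← induce_eq_coe_induce_top] at hφ
  refine ⟨ψ, fun u v p q hp hq hpS hqS hpn hqn => ?_⟩
  have := hφ _ _ (p.induce Sᶜ hpS) (q.induce Sᶜ hqS) (hpath p hpS hp) (hpath q hqS hq)
    (key p hpS hpn) (key q hqS hqn)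
  exact (Walk.map_induce p hpS).symm.trans
    ((congrArg (Walk.map (Embedding.induce Sᶜ).toHom) this).trans (Walk.map_induce q hqS))

/-- In the glued labeling, a nondecreasing path has a part with labels below `M`, lying wholly in
`T` or wholly outside `S`, and then at most two edges of label `M`. Two different paths with common
ends would yield two mates reached from one vertex by nondecreasing paths in `T`. -/
theorem not_isCritical_of_layer [Finite V] {S : Set V} {T : Set (Sym2 V)} {φ : Sym2 V → ℝ}
    (hS : S.Nonempty) (hTS : ∀ u v, s(u, v) ∈ T → u ∈ S)
    (huniq : ∀ s ∈ S, ∀ u u', G.Adj s u → s(s, u) ∉ T → G.Adj s u' → s(s, u') ∉ T → u = u')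
    (hgood : GoodOn G φ T)
    (hmates : ∀ (v s t : V) (p : G.Walk v s) (q : G.Walk v t),
      MonoPath φ T p → MonoPath φ T q → ¬ Mates G S T s t) :
    ¬ IsCritical G := by
  classical
  rintro ⟨hbad, hcrit⟩
  obtain ⟨ψ, hψ⟩ := (hcrit ((⊤ : G.Subgraph).induce Sᶜ) (by
    intro h
    obtain ⟨x, hx⟩ := hS
    have : x ∈ ((⊤ : G.Subgraph).induce Sᶜ).verts := by rw [h]; trivial
    exact this hx)).exists_on_compl
  obtain ⟨M₁, hM₁⟩ := (Set.finite_range φ).bddAbove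
  obtain ⟨M₂, hM₂⟩ := (Set.finite_range ψ).bddAbove
  set M := max M₁ M₂ + 1 with hM
  have hφM : ∀ e, φ e < M := fun e => by
    have := hM₁ ⟨e, rfl⟩; have := le_max_left M₁ M₂; linarith
  have hψM : ∀ e, ψ e < M := fun e => by
    have := hM₂ ⟨e, rfl⟩; have := le_max_right M₁ M₂; linarith
  have hTS' : ∀ u v, s(u, v) ∈ T → v ∈ S := fun u v h => hTS v u (by rwa [Sym2.eq_swap])
  set Φ : Sym2 V → ℝ := fun e => if e ∈ T then φ e else if ∃ x ∈ e, x ∈ S then M else ψ e with hΦ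
  have hΦT : ∀ e ∈ T, Φ e = φ e := fun e he => by simp [hΦ, he]
  have hΦN : ∀ a b, s(a, b) ∉ T → (a ∈ S ∨ b ∈ S) → Φ s(a, b) = M := fun a b h1 h2 => by
    simp [hΦ, h1, h2]
  have hΦO : ∀ a b, a ∉ S → b ∉ S → Φ s(a, b) = ψ s(a, b) := fun a b h1 h2 => by
    have : s(a, b) ∉ T := fun h => h1 (hTS _ _ h)
    simp [hΦ, h1, h2, this]
  have hΦle : ∀ e, Φ e ≤ M := fun e => by
    simp only [hΦ]; split_ifs
    exacts [(hφM e).le, le_rfl, (hψM e).le]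
  have hΦge : ∀ a b, ¬ Φ s(a, b) < M → s(a, b) ∉ T ∧ (a ∈ S ∨ b ∈ S) := fun a b h => by
    by_cases h1 : s(a, b) ∈ T
    · exact absurd ((hΦT _ h1).trans_lt (hφM _)) h
    · refine ⟨h1, ?_⟩
      by_contra! h2
      exact h ((hΦO _ _ h2.1 h2.2).trans_lt (hψM _))
  -- low walks
  have low_in : ∀ {u v : V} (p : G.Walk u v), (∀ e ∈ p.edges, Φ e < M) → u ∈ S →
      (∀ e ∈ p.edges, e ∈ T) ∧ v ∈ S := by
    intro u v p
    induction p with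
    | nil => intro _ h; simpa using h
    | @cons a b c hab p ih =>
      intro hl ha
      have h1 : s(a, b) ∈ T := by
        by_contra h1
        have := hl s(a, b) (by simp)
        rw [hΦN a b h1 (Or.inl ha)] at this
        exact lt_irrefl _ this
      obtain ⟨h2, h3⟩ := ih (fun e he => hl e (by simp [he])) (hTS' _ _ h1)
      refine ⟨?_, h3⟩
      intro e he
      rw [Walk.edges_cons, List.mem_cons] at he
      rcases he with rfl | he
      exacts [h1, h2 e he]
  have low_out : ∀ {u v : V} (p : G.Walk u v), (∀ e ∈ p.edges, Φ e < M) → u ∉ S →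
      (∀ e ∈ p.edges, Φ e = ψ e) ∧ ∀ x ∈ p.support, x ∉ S := by
    intro u v p
    induction p with
    | nil => intro _ h; simpa using h
    | @cons a b c hab p ih =>
      intro hl ha
      have hb : b ∉ S := by
        intro hb
        have h1 : s(a, b) ∉ T := fun h => ha (hTS _ _ h)
        have := hl s(a, b) (by simp)
        rw [hΦN a b h1 (Or.inr hb)] at this
        exact lt_irrefl _ this
      obtain ⟨h2, h3⟩ := ih (fun e he => hl e (by simp [he])) hb
      constructor
      · intro e he
        rw [Walk.edges_cons, List.mem_cons] at he
        rcases he with rfl | he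
        exacts [hΦO _ _ ha hb, h2 e he]
      · intro x hx
        rw [Walk.support_cons, List.mem_cons] at hx
        rcases hx with rfl | hx
        exacts [ha, h3 x hx]
  -- By `huniq`, two consecutive edges of label `M` meet outside `S`. The second one then ends in
  -- `S`, where no third can follow.
  have classify : ∀ {u v : V} (p : G.Walk u v), p.IsPath → Nondecreasing Φ p →
      (∀ e ∈ p.edges, Φ e < M) ∨
      (∃ (s : V) (p' : G.Walk u s) (h : G.Adj s v), p = p'.concat h ∧ (∀ e ∈ p'.edges, Φ e < M) ∧
        s(s, v) ∉ T ∧ (s ∈ S ∨ v ∈ S)) ∨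
      (∃ (s f : V) (p' : G.Walk u s) (h : G.Adj s f) (h' : G.Adj f v),
        p = (p'.concat h).concat h' ∧ (∀ e ∈ p'.edges, Φ e < M) ∧
        s(s, f) ∉ T ∧ s(f, v) ∉ T ∧ s ∈ S ∧ f ∉ S ∧ v ∈ S) := by
    intro u v p
    induction p using Walk.concatRec with
    | Hnil => intro _ _; left; simp
    | Hconcat p h ih =>
      rename_i a b c
      intro hp hn
      obtain ⟨hn1, hn2⟩ := nondecreasing_concat.1 hn
      obtain ⟨hp1, hp2⟩ := (Walk.concat_isPath_iff h).1 hp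
      by_cases hlow : Φ s(b, c) < M
      · left
        intro e he
        rw [Walk.edges_concat, List.concat_eq_append, List.mem_append] at he
        rcases he with he | he
        · exact (hn1 e he).trans_lt hlow
        · rw [List.mem_singleton] at he; rwa [he]
      obtain ⟨hT, hS'⟩ := hΦge _ _ hlow
      rcases ih hp1 hn2 with ih | ⟨s, p', h', rfl, hl, hT', hS''⟩ |
        ⟨s, f, p', h1, h2, rfl, hl, hT1, hT2, hs, hf, hb⟩
      · exact Or.inr (Or.inl ⟨b, p, h, rfl, ih, hT, hS'⟩)
      · have hsc : s ≠ c := by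
          rintro rfl
          exact hp2 (by simp [Walk.support_concat])
        have hb : b ∉ S := fun hb => hsc
          (huniq b hb s c h'.symm (by rwa [Sym2.eq_swap]) h hT)
        exact Or.inr (Or.inr ⟨s, b, p', h', h, rfl, hl, hT', hT, hS''.resolve_right hb, hb,
          hS'.resolve_left hb⟩)
      · exfalso
        have hfc : f ≠ c := by
          rintro rfl
          exact hp2 (by simp [Walk.support_concat])
        exact hfc (huniq b hb f c h2.symm (by rwa [Sym2.eq_swap]) h hT)
  have mono : ∀ {u v : V} (p : G.Walk u v), p.IsPath → Nondecreasing Φ p →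
      (∀ e ∈ p.edges, Φ e < M) → u ∈ S → MonoPath φ T p := by
    intro u v p hp hn hl hu
    have h1 := (low_in p hl hu).1
    exact ⟨hp, h1, hn.congr fun e he => hΦT e (h1 e he)⟩
  have key : ∀ {u v : V} (p q : G.Walk u v), p.IsPath → q.IsPath → Nondecreasing Φ p →
      Nondecreasing Φ q → (∀ e ∈ p.edges, Φ e < M) → (∀ e ∈ q.edges, Φ e < M) → p = q := by
    intro u v p q hp hq hpn hqn hpl hql
    by_cases hu : u ∈ S
    · exact hgood _ _ _ _ (mono p hp hpn hpl hu) (mono q hq hqn hql hu)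
    · obtain ⟨h1, h2⟩ := low_out p hpl hu
      obtain ⟨h3, h4⟩ := low_out q hql hu
      exact hψ _ _ _ _ hp hq h2 h4 (hpn.congr h1) (hqn.congr h3)
  have swapT : ∀ {a b : V}, s(a, b) ∉ T → s(b, a) ∉ T := fun h => by rwa [Sym2.eq_swap]
  -- A, B, C stand for the alternatives of `classify`, with 0, 1 and 2 edges of label `M`. Paths of
  -- different kinds never share both ends.
  have AB : ∀ {u v : V} (p q : G.Walk u v), p.IsPath → q.IsPath → Nondecreasing Φ p →
      Nondecreasing Φ q → (∀ e ∈ p.edges, Φ e < M) →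
      ¬ (∃ (s : V) (p' : G.Walk u s) (h : G.Adj s v), q = p'.concat h ∧
        (∀ e ∈ p'.edges, Φ e < M) ∧ s(s, v) ∉ T ∧ (s ∈ S ∨ v ∈ S)) := by
    rintro u v p q hp hq hpn hqn hpl ⟨s, q', h, rfl, hl, hT, hsv⟩
    have hq' := ((Walk.concat_isPath_iff h).1 hq).1
    have hqn' := (nondecreasing_concat.1 hqn).2
    by_cases hu : u ∈ S
    · exact hmates u s v q' p (mono q' hq' hqn' hl hu) (mono p hp hpn hpl hu)
        ⟨h.ne, Or.inl ⟨h, hT⟩⟩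
    · have h1 := (low_out q' hl hu).2 s (by simp)
      have h2 := (low_out p hpl hu).2 v (by simp)
      tauto
  have AC : ∀ {u v : V} (p q : G.Walk u v), p.IsPath → q.IsPath → Nondecreasing Φ p →
      Nondecreasing Φ q → (∀ e ∈ p.edges, Φ e < M) →
      ¬ (∃ (s f : V) (p' : G.Walk u s) (h : G.Adj s f) (h' : G.Adj f v),
        q = (p'.concat h).concat h' ∧ (∀ e ∈ p'.edges, Φ e < M) ∧
        s(s, f) ∉ T ∧ s(f, v) ∉ T ∧ s ∈ S ∧ f ∉ S ∧ v ∈ S) := by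
    rintro u v p q hp hq hpn hqn hpl ⟨s, f, q', h, h', rfl, hl, hT, hT', hs, hf, hv⟩
    obtain ⟨hq1, hq2⟩ := (Walk.concat_isPath_iff h').1 hq
    have hq' := ((Walk.concat_isPath_iff h).1 hq1).1
    have hqn' := (nondecreasing_concat.1 (nondecreasing_concat.1 hqn).2).2
    by_cases hu : u ∈ S
    · refine hmates u s v q' p (mono q' hq' hqn' hl hu) (mono p hp hpn hpl hu)
        ⟨?_, Or.inr ⟨f, hf, h.symm, h'⟩⟩
      rintro rfl
      exact hq2 (by simp [Walk.support_concat])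
    · exact (low_out q' hl hu).2 s (by simp) hs
  have BC : ∀ {u v : V} (p q : G.Walk u v), 
      (∃ (s : V) (p' : G.Walk u s) (h : G.Adj s v), p = p'.concat h ∧
        (∀ e ∈ p'.edges, Φ e < M) ∧ s(s, v) ∉ T ∧ (s ∈ S ∨ v ∈ S)) →
      ¬ (∃ (s f : V) (p' : G.Walk u s) (h : G.Adj s f) (h' : G.Adj f v),
        q = (p'.concat h).concat h' ∧ (∀ e ∈ p'.edges, Φ e < M) ∧
        s(s, f) ∉ T ∧ s(f, v) ∉ T ∧ s ∈ S ∧ f ∉ S ∧ v ∈ S) := by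
    rintro u v p q ⟨s, p', h, rfl, hl, hT, hsv⟩ ⟨s', f, q', h1, h2, rfl, hl', hT1, hT2, hs, hf, hv⟩
    have hsf := huniq v hv s f h.symm (swapT hT) h2.symm (swapT hT2)
    subst hsf
    by_cases hu : u ∈ S
    · exact hf (low_in p' hl hu).2
    · exact (low_out q' hl' hu).2 s' (by simp) hs
  refine hbad ⟨Φ, fun u v p q hp hq hpn hqn => ?_⟩
  rcases classify p hp hpn with hpl | hpB | hpC <;> rcases classify q hq hqn with hql | hqB | hqC
  · exact key p q hp hq hpn hqn hpl hql
  · exact (AB p q hp hq hpn hqn hpl hqB).elim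
  · exact (AC p q hp hq hpn hqn hpl hqC).elim
  · exact (AB q p hq hp hqn hpn hql hpB).elim
  · obtain ⟨s, p', h, rfl, hl, hT, hsv⟩ := hpB
    obtain ⟨s', q', h', rfl, hl', hT', hsv'⟩ := hqB
    have hp' := ((Walk.concat_isPath_iff h).1 hp).1
    have hpn' := (nondecreasing_concat.1 hpn).2
    have hq' := ((Walk.concat_isPath_iff h').1 hq).1
    have hqn' := (nondecreasing_concat.1 hqn).2
    have hss : s = s' := by
      by_cases hv : v ∈ S
      · exact huniq v hv s s' h.symm (swapT hT) h'.symm (swapT hT')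
      by_contra hne
      by_cases hu : u ∈ S
      · exact hmates u s s' p' q' (mono p' hp' hpn' hl hu) (mono q' hq' hqn' hl' hu)
          ⟨hne, Or.inr ⟨v, hv, h.symm, h'.symm⟩⟩
      · have := (low_out p' hl hu).2 s (by simp)
        tauto
    subst hss
    rw [key p' q' hp' hq' hpn' hqn' hl hl']
  · exact (BC p q hpB hqC).elim
  · exact (AC q p hq hp hqn hpn hql hpC).elim
  · exact (BC q p hqB hpC).elim
  · obtain ⟨s, f, p', h1, h2, rfl, hl, hT1, hT2, hs, hf, hv⟩ := hpC
    obtain ⟨s', f', q', h1', h2', rfl, hl', hT1', hT2', hs', hf', hv'⟩ := hqC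
    have hff := huniq v hv f f' h2.symm (swapT hT2) h2'.symm (swapT hT2')
    subst hff
    have hp' := ((Walk.concat_isPath_iff h1).1 ((Walk.concat_isPath_iff h2).1 hp).1).1
    have hpn' := (nondecreasing_concat.1 (nondecreasing_concat.1 hpn).2).2
    have hq' := ((Walk.concat_isPath_iff h1').1 ((Walk.concat_isPath_iff h2').1 hq).1).1
    have hqn' := (nondecreasing_concat.1 (nondecreasing_concat.1 hqn).2).2
    have hss : s = s' := by
      by_contra hne
      by_cases hu : u ∈ S
      · exact hmates u s s' p' q' (mono p' hp' hpn' hl hu) (mono q' hq' hqn' hl' hu)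
          ⟨hne, Or.inr ⟨f, hf, h1.symm, h1'.symm⟩⟩
      · exact (low_out p' hl hu).2 s (by simp) hs
    subst hss
    rw [key p' q' hp' hq' hpn' hqn' hl hl']

/-! ### Forests given by a parent relation -/

section Forest

theorem eq_nil_of_isPath {u : V} {p : G.Walk u u} (hp : p.IsPath) : p = Walk.nil := by
  cases p with
  | nil => rfl
  | cons h p => exact absurd p.end_mem_support ((Walk.cons_isPath_iff h p).1 hp).2

variable {R : V → V → Prop} {E : Set (Sym2 V)} {h : V → ℕ}

/-- A path that does not go to the parent of its start steps to a child, whose parent is the vertex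
just left. So it keeps moving away from the root. -/
theorem height_le_of_parent_notMem (hfun : ∀ w v v', R w v → R w v' → v = v')
    (hlt : ∀ w v, R w v → h v < h w) (hE : ∀ a b, s(a, b) ∈ E → R a b ∨ R b a)
    {w v : V} (p : G.Walk w v) (hp : p.IsPath) (hpE : ∀ e ∈ p.edges, e ∈ E) {u : V}
    (hu : R w u) (hus : u ∉ p.support) : h w ≤ h v := by
  induction p generalizing u with
  | nil => exact le_rfl
  | @cons a b c hab p ih =>
    obtain ⟨hp1, hp2⟩ := (Walk.cons_isPath_iff hab p).1 hp
    rcases hE a b (hpE _ (by simp)) with h1 | h1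
    · exact absurd (by simp [hfun _ _ _ hu h1]) hus
    · exact (hlt _ _ h1).le.trans (ih hp1 (fun e he => hpE e (by simp [he])) h1 hp2)

/-- Starting from the end of greater or equal height, a nontrivial path must first go to the parent,
since otherwise its other end would be higher still. So both paths share their first step. -/
theorem eq_of_parent (hfun : ∀ w v v', R w v → R w v' → v = v')
    (hlt : ∀ w v, R w v → h v < h w) (hE : ∀ a b, s(a, b) ∈ E → R a b ∨ R b a)
    {u v : V} (p q : G.Walk u v) (hp : p.IsPath) (hq : q.IsPath)
    (hpE : ∀ e ∈ p.edges, e ∈ E) (hqE : ∀ e ∈ q.edges, e ∈ E) : p = q := by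
  obtain ⟨n, hn⟩ : ∃ n, p.length + q.length ≤ n := ⟨_, le_rfl⟩
  induction n generalizing u v with
  | zero =>
    cases p with
    | nil => exact (eq_nil_of_isPath hq).symm
    | cons => simp at hn
  | succ n ih =>
    have step : ∀ {u v : V} (p q : G.Walk u v), p.IsPath → q.IsPath →
        (∀ e ∈ p.edges, e ∈ E) → (∀ e ∈ q.edges, e ∈ E) → p.length + q.length ≤ n + 1 →
        h v ≤ h u → p = q := by
      intro u v p q hp hq hpE hqE hn hle
      have up : ∀ {w : V} (hw : G.Adj u w) (p' : G.Walk w v), (Walk.cons hw p').IsPath →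
          (∀ e ∈ (Walk.cons hw p').edges, e ∈ E) → R u w := by
        intro w hw p' hp' hE'
        obtain ⟨hp1, hp2⟩ := (Walk.cons_isPath_iff hw p').1 hp'
        refine (hE u w (hE' _ (by simp))).resolve_right fun h1 => ?_
        have := height_le_of_parent_notMem hfun hlt hE p' hp1
          (fun e he => hE' e (by simp [he])) h1 hp2
        exact absurd (hlt _ _ h1) (by omega)
      cases p with
      | nil => exact (eq_nil_of_isPath hq).symm
      | @cons _ w _ hw p' =>
        cases q with
        | nil => exact eq_nil_of_isPath hp
        | @cons _ w' _ hw' q' =>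
          obtain rfl := hfun _ _ _ (up hw p' hp hpE) (up hw' q' hq hqE)
          rw [ih p' q' hp.of_cons hq.of_cons (fun e he => hpE e (by simp [he]))
            (fun e he => hqE e (by simp [he])) (by simp at hn; omega)]
    rcases le_total (h v) (h u) with hle | hle
    · exact step p q hp hq hpE hqE hn hle
    · have := step p.reverse q.reverse hp.reverse hq.reverse (by simpa using hpE)
        (by simpa using hqE) (by simpa using hn) hle
      simpa using congrArg Walk.reverse this

end Forest

/-! ### Spiders -/

section Spider

variable {ι : Type*} (G : SimpleGraph V) (y : V) (l : ι → ℕ) (q : ι → ℕ → V) (low : ι → Prop)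

/-- The vertices of the spider with axis `y` and legs `q i 0, …, q i (l i) = y`. -/
def spiderVerts : Set V := {v | v = y ∨ ∃ i m, m < l i ∧ v = q i m}

/-- The edges of the legs. -/
def spiderEdges : Set (Sym2 V) := {e | ∃ i m, m < l i ∧ e = s(q i m, q i (m + 1))}

/-- The edges of the legs except for the first edges of the low legs. -/
def upperEdges : Set (Sym2 V) :=
  {e | ∃ i m, m < l i ∧ ¬ (low i ∧ m = 0) ∧ e = s(q i m, q i (m + 1))}

/-- Legs `q i` run from their tips `q i 0` to the common axis `y`; they are disjoint except
for `y` and possibly common tips, and every vertex is on at most one edge of `G` outside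
the legs. Some legs are designated low. -/
structure Spider : Prop where
  pos : ∀ i, 1 ≤ l i
  last : ∀ i, q i (l i) = y
  adj : ∀ i m, m < l i → G.Adj (q i m) (q i (m + 1))
  ne_axis : ∀ i m, m < l i → q i m ≠ y
  inj : ∀ i j m n, m < l i → n < l j → q i m = q j n → (i = j ∧ m = n) ∨ (m = 0 ∧ n = 0)
  outer : ∀ s ∈ spiderVerts y l q, ∀ u u', G.Adj s u → s(s, u) ∉ spiderEdges l q →
    G.Adj s u' → s(s, u') ∉ spiderEdges l q → u = u'
  outer_shared : ∀ i j, i ≠ j → q i 0 = q j 0 → ∀ u, G.Adj (q i 0) u →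
    s(q i 0, u) ∈ spiderEdges l q
  low_two : ∀ i, low i → 2 ≤ l i
  low_shared : ∀ i j, i ≠ j → q i 0 = q j 0 → (low i ↔ ¬ low j)
  three_le : ∀ i j, i ≠ j → q i 0 = q j 0 → low i → 3 ≤ l i
  not_low : ∀ i, ¬ low i → 2 ≤ l i → ∃ j, j ≠ i ∧ q j 0 = q i 0

/-- Leg `j` must get a smaller label than leg `i`. -/
def Arc (i j : ι) : Prop :=
  i ≠ j ∧ ((low i ∧ l i = 2 ∧ ∃ n < l j, ¬ (low j ∧ n = 0) ∧
      Mates G (spiderVerts y l q) (spiderEdges l q) (q i 0) (q j n)) ∨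
    (q i 0 = q j 0 ∧ l i = 1))

open Classical in
/-- The label of the `m`-th edge of leg `i`. -/
noncomputable def legLabel (E : ι → ℝ) (N : ℝ) (i : ι) (m : ℕ) : ℝ :=
  if low i ∧ m = 0 then -1
  else if (low i ∧ 3 ≤ l i ∧ m = 1) ∨ (¬ low i ∧ 2 ≤ l i ∧ m = 0) then N else E i

variable {G y l q low}

namespace Spider

theorem inj_succ (hs : Spider G y l q low) {i j : ι} {m n : ℕ} (hm : m < l i) (hn : n < l j)
    (h : q i m = q j (n + 1)) : i = j ∧ m = n + 1 := by
  have hn' : n + 1 < l j := by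
    by_contra hlt
    have : n + 1 = l j := by omega
    exact hs.ne_axis i m hm (by rw [h, this, hs.last])
  rcases hs.inj _ _ _ _ hm hn' h with h | h
  · exact h
  · omega

/-- Of two legs with a common tip exactly one is low, so omitting low tips makes positions unique.
-/
theorem inj_not_low (hs : Spider G y l q low) {i j : ι} {m n : ℕ} (hm : m < l i) (hn : n < l j)
    (hi : ¬ (low i ∧ m = 0)) (hj : ¬ (low j ∧ n = 0)) (h : q i m = q j n) : i = j ∧ m = n := by
  rcases hs.inj _ _ _ _ hm hn h with h' | ⟨rfl, rfl⟩
  · exact h'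
  · by_contra hne
    have := hs.low_shared i j (by tauto) h
    tauto

theorem edge_inj (hs : Spider G y l q low) {i j : ι} {m n : ℕ} (hm : m < l i) (hn : n < l j)
    (h : s(q i m, q i (m + 1)) = s(q j n, q j (n + 1))) : i = j ∧ m = n := by
  rw [Sym2.eq_iff] at h
  rcases h with ⟨h1, h2⟩ | ⟨h1, h2⟩
  · rcases hs.inj _ _ _ _ hm hn h1 with h' | ⟨rfl, rfl⟩
    · exact h'
    · refine ⟨?_, rfl⟩
      by_contra hne
      by_cases hi : low i
      · have := hs.three_le i j hne h1 hi
        exact hne (hs.inj_succ (by omega) hn h2).1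
      · have hj : low j := by
          have := hs.low_shared i j hne h1
          tauto
        have := hs.three_le j i (Ne.symm hne) h1.symm hj
        exact hne (hs.inj_succ (by omega) hm h2.symm).1.symm
  · have h3 := hs.inj_succ hm hn h1
    have h4 := hs.inj_succ hn hm h2.symm
    omega

theorem exists_label (hs : Spider G y l q low) (E : ι → ℝ) (N : ℝ) : ∃ φ : Sym2 V → ℝ,
    ∀ i m, m < l i → φ s(q i m, q i (m + 1)) = legLabel l low E N i m := by
  classical
  refine ⟨fun e => if h : ∃ im : ι × ℕ, im.2 < l im.1 ∧ e = s(q im.1 im.2, q im.1 (im.2 + 1))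
    then legLabel l low E N h.choose.1 h.choose.2 else 0, fun i m hm => ?_⟩
  have h : ∃ im : ι × ℕ, im.2 < l im.1 ∧
    s(q i m, q i (m + 1)) = s(q im.1 im.2, q im.1 (im.2 + 1)) := ⟨(i, m), hm, rfl⟩
  have h' := h.choose_spec
  obtain ⟨h1, h2⟩ := hs.edge_inj hm h'.1 h'.2
  simp only [dif_pos h]
  rw [← h1, ← h2]

theorem exists_height (hs : Spider G y l q low) : ∃ h : V → ℕ,
    ∀ i m, m ≤ l i → ¬ (low i ∧ m = 0) → h (q i m) = l i - m := by
  classical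
  refine ⟨fun v => if h : ∃ im : ι × ℕ, im.2 ≤ l im.1 ∧ ¬ (low im.1 ∧ im.2 = 0) ∧
    v = q im.1 im.2 then l h.choose.1 - h.choose.2 else 0, fun i m hm hU => ?_⟩
  have h : ∃ im : ι × ℕ, im.2 ≤ l im.1 ∧ ¬ (low im.1 ∧ im.2 = 0) ∧ q i m = q im.1 im.2 :=
    ⟨(i, m), hm, hU, rfl⟩
  simp only [dif_pos h]
  obtain ⟨h1, h2, h3⟩ := h.choose_spec
  generalize h.choose.1 = j at *
  generalize h.choose.2 = n at *
  rcases hm.lt_or_eq with hm | rfl <;> rcases h1.lt_or_eq with h1 | rfl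
  · obtain ⟨rfl, rfl⟩ := hs.inj_not_low hm h1 hU h2 h3
    rfl
  · exact absurd (h3.trans (hs.last j)) (hs.ne_axis _ _ hm)
  · exact absurd (h3.symm.trans (hs.last i)) (hs.ne_axis _ _ h1)
  · omega

/-- Removing the first edges of the low legs leaves a forest: the parent of `q i m` is `q i (m +
1)`, and a shared tip keeps only its parent on the leg that is not low. The height is the distance
to the axis along the leg. -/
theorem upper_good (hs : Spider G y l q low) {u v : V} (p p' : G.Walk u v) (hp : p.IsPath)
    (hp' : p'.IsPath) (hpE : ∀ e ∈ p.edges, e ∈ upperEdges l q low)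
    (hpE' : ∀ e ∈ p'.edges, e ∈ upperEdges l q low) : p = p' := by
  obtain ⟨h, hh⟩ := hs.exists_height
  refine eq_of_parent (R := fun w v => ∃ i m, m < l i ∧ ¬ (low i ∧ m = 0) ∧ w = q i m ∧
    v = q i (m + 1)) (h := h) (E := upperEdges l q low) ?_ ?_ ?_ p p' hp hp' hpE hpE'
  · rintro w v v' ⟨i, m, hm, hU, rfl, rfl⟩ ⟨j, n, hn, hU', h1, rfl⟩
    obtain ⟨rfl, rfl⟩ := hs.inj_not_low hm hn hU hU' h1
    rfl
  · rintro w v ⟨i, m, hm, hU, rfl, rfl⟩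
    rw [hh i m hm.le hU, hh i (m + 1) hm (by simp)]
    omega
  · rintro a b ⟨i, m, hm, hU, he⟩
    rw [Sym2.eq_iff] at he
    rcases he with ⟨rfl, rfl⟩ | ⟨rfl, rfl⟩
    · exact Or.inl ⟨i, m, hm, hU, rfl, rfl⟩
    · exact Or.inr ⟨i, m, hm, hU, rfl, rfl⟩

theorem upper_step (hs : Spider G y l q low) {i : ι} {m : ℕ} {w : V} (hm : m < l i)
    (hU : ¬ (low i ∧ m = 0)) (h : s(q i m, w) ∈ upperEdges l q low) :
    w = q i (m + 1) ∨ ∃ n, m = n + 1 ∧ w = q i n ∧ ¬ (low i ∧ n = 0) := by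
  obtain ⟨j, n, hn, hU', he⟩ := h
  rw [Sym2.eq_iff] at he
  rcases he with ⟨h1, rfl⟩ | ⟨h1, rfl⟩
  · obtain ⟨rfl, rfl⟩ := hs.inj_not_low hm hn hU hU' h1
    exact Or.inl rfl
  · obtain ⟨rfl, rfl⟩ := hs.inj_succ hm hn h1
    exact Or.inr ⟨n, rfl, rfl, hU'⟩

theorem upper_step_axis (hs : Spider G y l q low) {w : V} (h : s(y, w) ∈ upperEdges l q low) :
    ∃ i n, n + 1 = l i ∧ ¬ (low i ∧ n = 0) ∧ w = q i n := by
  obtain ⟨j, n, hn, hU', he⟩ := h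
  rw [Sym2.eq_iff] at he
  rcases he with ⟨h1, rfl⟩ | ⟨h1, rfl⟩
  · exact absurd h1.symm (hs.ne_axis _ _ hn)
  · refine ⟨j, n, ?_, hU', rfl⟩
    by_contra hne
    exact hs.ne_axis j (n + 1) (by omega) h1.symm

theorem upper_step_tip (hs : Spider G y l q low) {i : ι} {w : V} (hi : low i)
    (hfree : ∀ j, j ≠ i → q j 0 ≠ q i 0) (h : s(q i 0, w) ∈ upperEdges l q low) : False := by
  obtain ⟨j, n, hn, hU', he⟩ := h
  have hp := hs.pos i
  rw [Sym2.eq_iff] at he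
  rcases he with ⟨h1, rfl⟩ | ⟨h1, rfl⟩
  · rcases hs.inj _ _ _ _ hp hn h1 with ⟨rfl, rfl⟩ | ⟨-, rfl⟩
    · exact hU' ⟨hi, rfl⟩
    · by_cases hji : j = i
      · subst hji; exact hU' ⟨hi, rfl⟩
      · exact hfree j hji h1.symm
  · have := (hs.inj_succ hp hn h1).2
    omega

/-! ### Nondecreasing paths in a labeled spider -/

variable {E : ι → ℝ} {N : ℝ} {φ : Sym2 V → ℝ}

theorem upper_down (hs : Spider G y l q low) {w v : V} (p : G.Walk w v)
    (hp : MonoPath φ (upperEdges l q low) p) {i : ι} {m : ℕ} (hm : m < l i)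
    (hU : ¬ (low i ∧ m = 0)) (hw : w = q i m) (hpar : q i (m + 1) ∉ p.support) :
    ∃ n ≤ m, ¬ (low i ∧ n = 0) ∧ v = q i n := by
  induction p generalizing m with
  | nil => exact ⟨m, le_rfl, hU, hw⟩
  | @cons a b c hab p ih =>
    subst hw
    rcases hs.upper_step hm hU hp.head_mem with rfl | ⟨n, rfl, rfl, hU'⟩
    · simp at hpar
    · obtain ⟨n', h1, h2⟩ := ih hp.of_cons (by omega) hU' rfl hp.notMem
      exact ⟨n', by omega, h2⟩

theorem label_last {i : ι} {n : ℕ} (hn : n + 1 = l i)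
    (hU : ¬ (low i ∧ n = 0)) : legLabel l low E N i n = E i := by
  have : ¬ ((low i ∧ 3 ≤ l i ∧ n = 1) ∨ (¬ low i ∧ 2 ≤ l i ∧ n = 0)) := by
    rintro (⟨-, h⟩ | ⟨-, h⟩) <;> omega
  simp [legLabel, hU, this]

theorem upper_axis (hs : Spider G y l q low)
    (hφ : ∀ i m, m < l i → φ s(q i m, q i (m + 1)) = legLabel l low E N i m)
    {v : V} (p : G.Walk y v) (hp : MonoPath φ (upperEdges l q low) p) {b : ℝ}
    (hb : ∀ e ∈ p.edges, b ≤ φ e) :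
    v = y ∨ ∃ i n, n < l i ∧ ¬ (low i ∧ n = 0) ∧ v = q i n ∧ b ≤ E i ∧
      q i (l i - 1) ∈ p.support := by
  cases p with
  | nil => exact Or.inl rfl
  | @cons _ w _ h p =>
    right
    obtain ⟨i, n, hn, hU, rfl⟩ := hs.upper_step_axis hp.head_mem
    have hy : q i (n + 1) = y := by rw [hn, hs.last]
    obtain ⟨n', h1, h2, h3⟩ := hs.upper_down p hp.of_cons (by omega) hU rfl
      (by rw [hy]; exact hp.notMem)
    refine ⟨i, n', by omega, h2, h3, ?_, ?_⟩
    · have := hb s(y, q i n) (by simp)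
      have h4 := hφ i n (by omega)
      rw [hy, Sym2.eq_swap] at h4
      rwa [h4, label_last hn hU] at this
    · have : l i - 1 = n := by omega
      simp [this]

/-- The edge with label `N` is followed by one with label `E i < N`, so a nondecreasing path
crossing it stops. `hmin` says that no upper edge leads towards the tip. -/
theorem upper_peak (hs : Spider G y l q low) (hE : ∀ i, E i < N)
    (hφ : ∀ i m, m < l i → φ s(q i m, q i (m + 1)) = legLabel l low E N i m)
    {i : ι} {m : ℕ} (hm : m + 1 < l i)
    (hU : ¬ (low i ∧ m = 0)) (hlab : legLabel l low E N i m = N) (hmin : ∀ n, m = n + 1 → low i ∧ n = 0)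
    {v : V} (p : G.Walk (q i m) v) (hp : MonoPath φ (upperEdges l q low) p) :
    v = q i m ∨ v = q i (m + 1) := by
  cases p with
  | nil => exact Or.inl rfl
  | @cons _ w _ h p =>
    right
    rcases hs.upper_step (by omega) hU hp.head_mem with rfl | ⟨n, h1, -, h2⟩
    · cases p with
      | nil => rfl
      | @cons _ w' _ h' p =>
        exfalso
        have h1 := hp.head_le s(q i (m + 1), w') (by simp)
        rw [hφ i m (by omega), hlab] at h1
        rcases hs.upper_step hm (by simp) hp.of_cons.head_mem with rfl | ⟨n, h2, rfl, -⟩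
        · rw [hφ i (m + 1) hm] at h1
          have h3 : ¬ (low i ∧ 3 ≤ l i ∧ m + 1 = 1) := fun h => hU ⟨h.1, by omega⟩
          have : legLabel l low E N i (m + 1) = E i := by
            rw [legLabel, if_neg (by simp), if_neg (by tauto)]
          rw [this] at h1
          exact absurd h1 (not_le.2 (hE i))
        · obtain rfl : m = n := by omega
          exact hp.notMem (by simp)
    · exact absurd (hmin n h1) h2

/-- Passing through the axis from leg `i` to leg `j` compares their last labels, which are `E i` and
`E j`. -/
theorem upper_to_axis (hs : Spider G y l q low)
    (hφ : ∀ i m, m < l i → φ s(q i m, q i (m + 1)) = legLabel l low E N i m)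
    {i : ι} {m : ℕ} (hm : m + 1 = l i)
    (hU : ¬ (low i ∧ m = 0)) (hmin : ∀ n, m = n + 1 → low i ∧ n = 0)
    {v : V} (p : G.Walk (q i m) v) (hp : MonoPath φ (upperEdges l q low) p) :
    v = q i m ∨ v = y ∨ ∃ j n, n < l j ∧ ¬ (low j ∧ n = 0) ∧ v = q j n ∧ E i ≤ E j ∧ j ≠ i := by
  cases p with
  | nil => exact Or.inl rfl
  | @cons _ w _ h p =>
    right
    have hy : q i (m + 1) = y := by rw [hm, hs.last]
    rcases hs.upper_step (by omega) hU hp.head_mem with rfl | ⟨n, h1, -, h2⟩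
    · have hle := hp.head_le
      rw [hφ i m (by omega), label_last hm hU] at hle
      have hnot := hp.notMem
      have hp' := hp.of_cons
      clear hp
      generalize q i (m + 1) = z at *
      subst hy
      rcases hs.upper_axis hφ p hp' hle with rfl | ⟨j, n, h1, h2, h3, h4, h5⟩
      · exact Or.inl rfl
      · refine Or.inr ⟨j, n, h1, h2, h3, h4, ?_⟩
        rintro rfl
        have : l j - 1 = m := by omega
        rw [this] at h5
        exact hnot h5
    · exact absurd (hmin n h1) h2

theorem low_edge_unique (hs : Spider G y l q low) {i j : ι} (hi : low i) (hj : low j) {x : V}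
    (hxi : x ∈ s(q i 0, q i 1)) (hxj : x ∈ s(q j 0, q j 1)) : i = j := by
  have hli := hs.low_two i hi
  have hlj := hs.low_two j hj
  rw [Sym2.mem_iff] at hxi hxj
  rcases hxi with rfl | rfl <;> rcases hxj with h | h
  · by_contra hne
    have := hs.low_shared i j hne h
    tauto
  · exact (hs.inj_succ (by omega) (by omega) h).1
  · exact (hs.inj_succ (by omega) (by omega) h.symm).1.symm
  · exact (hs.inj_succ (by omega) (by omega) h).1

theorem mem_upper_or_low {e : Sym2 V} (he : e ∈ spiderEdges l q) :
    e ∈ upperEdges l q low ∨ ∃ i, low i ∧ e = s(q i 0, q i 1) := by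
  obtain ⟨i, m, hm, rfl⟩ := he
  by_cases h : low i ∧ m = 0
  · obtain ⟨h, rfl⟩ := h
    exact Or.inr ⟨i, h, rfl⟩
  · exact Or.inl ⟨i, m, hm, h, rfl⟩

theorem monoPath_upper_of_head (hs : Spider G y l q low) (hE0 : ∀ i, 0 ≤ E i) (hE : ∀ i, E i < N)
    (hφ : ∀ i m, m < l i → φ s(q i m, q i (m + 1)) = legLabel l low E N i m)
    {u w v : V} {h : G.Adj u w} {p : G.Walk w v} (hp : MonoPath φ (spiderEdges l q) (Walk.cons h p))
    (hU : s(u, w) ∈ upperEdges l q low) : MonoPath φ (upperEdges l q low) (Walk.cons h p) := by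
  refine ⟨hp.isPath, fun e he => ?_, hp.mono⟩
  rw [Walk.edges_cons, List.mem_cons] at he
  rcases he with rfl | he
  · exact hU
  · have hle := hp.head_le e he
    refine (mem_upper_or_low (hp.edges_mem e (by simp [he]))).resolve_right ?_
    rintro ⟨i, hi, rfl⟩
    obtain ⟨j, n, hn, hUj, hj⟩ := hU
    have hi0 : legLabel l low E N i 0 = -1 := if_pos ⟨hi, rfl⟩
    rw [hj, hφ i 0 (hs.pos i), hφ j n hn, hi0, legLabel, if_neg hUj] at hle
    have h1 := hE0 j
    have h2 := hE j
    split_ifs at hle <;> linarith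

/-- The first edges of low legs carry the least label and are pairwise disjoint, so a nondecreasing
path uses at most one of them, and only at its start. -/
theorem monoPath_cases (hs : Spider G y l q low) (hE0 : ∀ i, 0 ≤ E i) (hE : ∀ i, E i < N)
    (hφ : ∀ i m, m < l i → φ s(q i m, q i (m + 1)) = legLabel l low E N i m)
    {u v : V} (p : G.Walk u v) (hp : MonoPath φ (spiderEdges l q) p) :
    MonoPath φ (upperEdges l q low) p ∨ ∃ (i : ι) (w : V) (h : G.Adj u w) (p' : G.Walk w v),
      low i ∧ s(u, w) = s(q i 0, q i 1) ∧ p = Walk.cons h p' ∧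
      MonoPath φ (upperEdges l q low) p' := by
  cases p with
  | nil => exact Or.inl ⟨hp.isPath, by simp, hp.mono⟩
  | @cons _ w _ h p =>
    rcases mem_upper_or_low hp.head_mem with hU | ⟨i, hi, he⟩
    · exact Or.inl (hs.monoPath_upper_of_head hE0 hE hφ hp hU)
    · refine Or.inr ⟨i, w, h, p, hi, he, rfl, ?_⟩
      have hp' := hp.of_cons
      cases p with
      | nil => exact ⟨hp'.isPath, by simp, hp'.mono⟩
      | @cons _ w' _ h' p =>
        rcases mem_upper_or_low hp'.head_mem with hU | ⟨j, hj, he'⟩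
        · exact hs.monoPath_upper_of_head hE0 hE hφ hp' hU
        · obtain rfl : i = j := hs.low_edge_unique hi hj (x := w) (by simp [← he]) (by simp [← he'])
          rw [← he] at he'
          have hw : w' = u := by
            rw [Sym2.eq_swap] at he'
            exact (Sym2.congr_left.1 he')
          subst hw
          exact absurd (by simp) hp.notMem

theorem eq_tip_of_upper (hs : Spider G y l q low) {i : ι} (hi : low i)
    (hfree : ∀ j, j ≠ i → q j 0 ≠ q i 0) {v : V} (p : G.Walk (q i 0) v)
    (hp : ∀ e ∈ p.edges, e ∈ upperEdges l q low) : v = q i 0 := by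
  cases p with
  | nil => rfl
  | @cons _ w _ h p => exact (hs.upper_step_tip hi hfree (hp s(q i 0, w) (by simp))).elim

/-- This prevents nondecreasing paths from going both ways round the cycle of two legs with a common
tip. On the low leg, label `N` stops the path at `q j 2` at the latest. On the other leg `i`, label
`N` stops it after one step, or the leg is a single edge and the arc from `i` to `j` gives `E j < E
i`, which keeps the path off leg `j`. -/
theorem upper_no_meet (hs : Spider G y l q low) (hE : ∀ i, E i < N)
    (harc : ∀ i j, Arc G y l q low i j → E j < E i)
    (hφ : ∀ i m, m < l i → φ s(q i m, q i (m + 1)) = legLabel l low E N i m)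
    {j : ι} (hj : low j) {v : V} (a : G.Walk (q j 0) v) (b : G.Walk (q j 1) v)
    (ha : MonoPath φ (upperEdges l q low) a) (hb : MonoPath φ (upperEdges l q low) b) : False := by
  have hl2 := hs.low_two j hj
  by_cases hfree : ∀ i, i ≠ j → q i 0 ≠ q j 0
  · obtain rfl := hs.eq_tip_of_upper hj hfree a ha.edges_mem
    have := hs.eq_tip_of_upper hj hfree b.reverse (by simpa using hb.edges_mem)
    exact (hs.adj j 0 (by omega)).ne this.symm
  · push Not at hfree
    obtain ⟨i, hij, h0⟩ := hfree
    have hl3 := hs.three_le j i hij.symm h0.symm hj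
    have hi : ¬ low i := (hs.low_shared j i hij.symm h0.symm).1 hj
    have hb' := hs.upper_peak hE hφ (i := j) (m := 1) (by omega) (by simp)
      (by rw [legLabel, if_neg (by simp), if_pos (by tauto)])
      (fun n hn => ⟨hj, by omega⟩) b hb
    have key : ∀ (n : ℕ), n < l j → n ≠ 0 → v = q j n → ∀ x, x = q i 0 → ∀ a : G.Walk x v,
        MonoPath φ (upperEdges l q low) a → False := by
      rintro n hn hn0 rfl _ rfl a ha
      have hli := hs.pos i
      rcases Nat.lt_or_ge 1 (l i) with h2 | h2
      · rcases hs.upper_peak hE hφ (i := i) (m := 0) (by omega) (by tauto)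
          (by rw [legLabel, if_neg (by tauto), if_pos (Or.inr ⟨hi, h2, rfl⟩)])
          (fun n hn => by omega) a ha with h | h
        · rcases hs.inj _ _ _ _ hn hli h with h | h
          · omega
          · omega
        · exact hij (hs.inj_succ hn hli h).1.symm
      · rcases hs.upper_to_axis hφ (i := i) (m := 0) (by omega) (by tauto)
          (fun n hn => by omega) a ha with h | h | ⟨k, n', h1, h3, h4, h5, h6⟩
        · rcases hs.inj _ _ _ _ hn hli h with h | h
          · omega
          · omega
        · exact hs.ne_axis _ _ hn h
        · obtain ⟨rfl, rfl⟩ := hs.inj_not_low hn h1 (by tauto) h3 h4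
          have := harc i j ⟨hij, Or.inr ⟨h0, by omega⟩⟩
          linarith
    rcases hb' with h | h
    · exact key 1 (by omega) (by simp) h _ h0.symm a ha
    · exact key 2 (by omega) (by simp) h _ h0.symm a ha

theorem goodOn (hs : Spider G y l q low) (hE0 : ∀ i, 0 ≤ E i) (hE : ∀ i, E i < N)
    (harc : ∀ i j, Arc G y l q low i j → E j < E i)
    (hφ : ∀ i m, m < l i → φ s(q i m, q i (m + 1)) = legLabel l low E N i m) :
    GoodOn G φ (spiderEdges l q) := by
  have meet : ∀ {u w v : V} {j : ι} (a : G.Walk u v) (b : G.Walk w v), low j →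
      s(u, w) = s(q j 0, q j 1) → MonoPath φ (upperEdges l q low) a →
      MonoPath φ (upperEdges l q low) b → False := by
    intro u w v j a b hj he ha hb
    rw [Sym2.eq_iff] at he
    rcases he with ⟨rfl, rfl⟩ | ⟨rfl, rfl⟩
    · exact hs.upper_no_meet hE harc hφ hj a b ha hb
    · exact hs.upper_no_meet hE harc hφ hj b a hb ha
  intro u v p p' hp hp'
  rcases hs.monoPath_cases hE0 hE hφ p hp with hpU | ⟨i, w, h, r, hi, he, rfl, hr⟩ <;>
  rcases hs.monoPath_cases hE0 hE hφ p' hp' with hpU' | ⟨i', w', h', r', hi', he', rfl, hr'⟩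
  · exact hs.upper_good p p' hpU.isPath hpU'.isPath hpU.edges_mem hpU'.edges_mem
  · exact (meet _ _ hi' he' hpU hr').elim
  · exact (meet _ _ hi he hpU' hr).elim
  · obtain rfl : i = i' := hs.low_edge_unique hi hi' (x := u) (by simp [← he]) (by simp [← he'])
    obtain rfl : w = w' := Sym2.congr_right.1 (he.trans he'.symm)
    rw [hs.upper_good r r' hr.isPath hr'.isPath hr.edges_mem hr'.edges_mem]

theorem mem_verts_of_mem_edges (hs : Spider G y l q low) {u v : V}
    (h : s(u, v) ∈ spiderEdges l q) : u ∈ spiderVerts y l q := by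
  obtain ⟨i, m, hm, he⟩ := h
  rw [Sym2.eq_iff] at he
  rcases he with ⟨rfl, rfl⟩ | ⟨rfl, rfl⟩
  · exact Or.inr ⟨i, m, hm, rfl⟩
  · rcases (Nat.succ_le_of_lt hm).lt_or_eq with h | h
    · exact Or.inr ⟨i, m + 1, h, rfl⟩
    · left
      rw [← hs.last i, ← h]

theorem free_of_mates (hs : Spider G y l q low) {i : ι} {t : V}
    (hm : Mates G (spiderVerts y l q) (spiderEdges l q) (q i 0) t) :
    ∀ j, j ≠ i → q j 0 ≠ q i 0 := by
  intro j hj h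
  obtain ⟨hne, ⟨h1, h2⟩ | ⟨f, hf, h1, h2⟩⟩ := hm
  · exact h2 (hs.outer_shared i j hj.symm h.symm _ h1)
  · have := hs.outer_shared i j hj.symm h.symm _ h1.symm
    rw [Sym2.eq_swap] at this
    exact hf (hs.mem_verts_of_mem_edges this)

/-- A low tip with a mate is not shared, so it is reached only from itself and from `q i 1`. If the
leg has length at least 3, label `N` stops paths from `q i 1` at `q i 2`, too close to the tip for a
mate by the girth. If it has length 2, such a path enters a leg `j` only if `E i ≤ E j`, against the
arc that the mate creates. -/
theorem not_mates_of_reach (hs : Spider G y l q low) (hE0 : ∀ i, 0 ≤ E i) (hE : ∀ i, E i < N)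
    (harc : ∀ i j, Arc G y l q low i j → E j < E i)
    (hφ : ∀ i m, m < l i → φ s(q i m, q i (m + 1)) = legLabel l low E N i m)
    (htri : ∀ a b c, G.Adj a b → G.Adj b c → G.Adj c a → False)
    (hC4 : ∀ a b c d, a ≠ c → b ≠ d → G.Adj a b → G.Adj b c → G.Adj c d → G.Adj d a → False)
    {i : ι} (hi : low i) {v t : V}
    (p : G.Walk v (q i 0)) (p' : G.Walk v t) (hp : MonoPath φ (spiderEdges l q) p)
    (hp' : MonoPath φ (spiderEdges l q) p')
    (hm : Mates G (spiderVerts y l q) (spiderEdges l q) (q i 0) t) : False := by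
  have hfree := hs.free_of_mates hm
  have hl2 := hs.low_two i hi
  have hne : t ≠ q i 0 := hm.1.symm
  have to_tip : ∀ {w : V} (a : G.Walk w (q i 0)), (∀ e ∈ a.edges, e ∈ upperEdges l q low) →
      w = q i 0 := fun a ha =>
    hs.eq_tip_of_upper hi hfree a.reverse (by simpa using ha)
  have hv : v = q i 0 ∨ v = q i 1 := by
    rcases hs.monoPath_cases hE0 hE hφ p hp with hpU | ⟨j, w, h, r, hj, he, rfl, hr⟩
    · exact Or.inl (to_tip p hpU.edges_mem)
    · obtain rfl := to_tip r hr.edges_mem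
      obtain rfl : i = j := hs.low_edge_unique hi hj (x := q i 0) (by simp) (by simp [← he])
      have : v ∈ s(q i 0, q i 1) := by simp [← he]
      simpa using this
  obtain ⟨r, hr⟩ : ∃ r : G.Walk (q i 1) t, MonoPath φ (upperEdges l q low) r := by
    rcases hs.monoPath_cases hE0 hE hφ p' hp' with hpU | ⟨j, w, h, r, hj, he, rfl, hr⟩
    · rcases hv with rfl | rfl
      · exact absurd (hs.eq_tip_of_upper hi hfree p' hpU.edges_mem) hne
      · exact ⟨p', hpU⟩
    · obtain rfl : i = j := hs.low_edge_unique hi hj (x := v)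
        (by rcases hv with rfl | rfl <;> simp) (by simp [← he])
      rcases hv with rfl | rfl
      · obtain rfl := Sym2.congr_right.1 he
        exact ⟨r, hr⟩
      · rw [Sym2.eq_swap] at he
        obtain rfl := Sym2.congr_left.1 he
        exact absurd (hs.eq_tip_of_upper hi hfree r hr.edges_mem) hne
  have a01 := hs.adj i 0 (by omega)
  have a12 := hs.adj i 1 (by omega)
  -- the vertices at distance at most two are not mates of the tip
  have near1 : t ≠ q i 1 := by
    rintro rfl
    obtain ⟨-, ⟨-, h⟩ | ⟨f, -, h1, h2⟩⟩ := hm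
    · exact h ⟨i, 0, by omega, rfl⟩
    · exact htri _ _ _ a01 h2.symm h1
  have near2 : t ≠ q i 2 := by
    rintro rfl
    obtain ⟨-, ⟨h, -⟩ | ⟨f, hf, h1, h2⟩⟩ := hm
    · exact htri _ _ _ a01 a12 h.symm
    · refine hC4 _ _ _ _ hne.symm ?_ a01 a12 h2.symm h1
      rintro rfl
      exact hf (Or.inr ⟨i, 1, by omega, rfl⟩)
  rcases hl2.lt_or_eq with hl3 | hl3
  · rcases hs.upper_peak hE hφ (i := i) (m := 1) (by omega) (by simp)
      (by rw [legLabel, if_neg (by simp), if_pos (by tauto)])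
      (fun n hn => ⟨hi, by omega⟩) r hr with h | h
    · exact near1 h
    · exact near2 h
  · rcases hs.upper_to_axis hφ (i := i) (m := 1) (by omega) (by simp)
      (fun n hn => ⟨hi, by omega⟩) r hr with h | h | ⟨j, n, h1, h2, rfl, h4, h5⟩
    · exact near1 h
    · exact near2 (by rw [h, hl3, hs.last])
    · have := harc i j ⟨h5.symm, Or.inl ⟨hi, hl3.symm, n, h1, h2, hm⟩⟩
      linarith

/-- The spider argument: in a critical graph without short cycles, the arcs of a spider
whose mates all involve low tips contain a directed cycle. -/
theorem exists_transGen_arc [Finite V] [Finite ι] (hs : Spider G y l q low) (hcrit : IsCritical G)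
    (htri : ∀ a b c, G.Adj a b → G.Adj b c → G.Adj c a → False)
    (hC4 : ∀ a b c d, a ≠ c → b ≠ d → G.Adj a b → G.Adj b c → G.Adj c d → G.Adj d a → False)
    (hm : ∀ s ∈ spiderVerts y l q, ∀ t ∈ spiderVerts y l q,
      Mates G (spiderVerts y l q) (spiderEdges l q) s t →
      ∃ i, low i ∧ (s = q i 0 ∨ t = q i 0)) :
    ∃ i, Relation.TransGen (Arc G y l q low) i i := by
  by_contra! hacyc
  let A := Relation.TransGen (Arc G y l q low)
  -- Without directed cycles, the number of legs reachable along arcs drops strictly along each arc.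
  let E : ι → ℝ := fun i => ({j | A i j} : Set ι).ncard
  have harc : ∀ i j, Arc G y l q low i j → E j < E i := by
    intro i j hij
    have : ({k | A j k} : Set ι) ⊂ {k | A i k} := by
      refine ⟨fun k hk => Relation.TransGen.head hij hk, fun h => ?_⟩
      exact hacyc j (h (show j ∈ {k | A i k} from Relation.TransGen.single hij))
    exact Nat.cast_lt.2 (Set.ncard_lt_ncard this (Set.toFinite _))
  have hE0 : ∀ i, 0 ≤ E i := fun i => Nat.cast_nonneg _
  have hE : ∀ i, E i < (Nat.card ι : ℝ) + 1 := fun i => by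
    have : ({j | A i j} : Set ι).ncard ≤ Nat.card ι := Set.ncard_le_card _
    have : E i ≤ (Nat.card ι : ℝ) := Nat.cast_le.2 this
    linarith
  obtain ⟨φ, hφ⟩ := hs.exists_label E ((Nat.card ι : ℝ) + 1)
  refine not_isCritical_of_layer (S := spiderVerts y l q) (T := spiderEdges l q) (φ := φ)
    ⟨y, Or.inl rfl⟩ (fun u v h => hs.mem_verts_of_mem_edges h) hs.outer
    (hs.goodOn hE0 hE harc hφ) ?_ hcrit
  intro v s t p p' hp hp' hst
  have hv : v ∈ spiderVerts y l q := by
    cases p with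
    | cons h p => exact hs.mem_verts_of_mem_edges hp.head_mem
    | nil =>
      cases p' with
      | cons h p' => exact hs.mem_verts_of_mem_edges hp'.head_mem
      | nil => exact absurd rfl hst.1
  have hmem : ∀ {w : V} (a : G.Walk v w), MonoPath φ (spiderEdges l q) a →
      w ∈ spiderVerts y l q := by
    intro w a ha
    by_cases hnil : a.reverse.Nil
    · rwa [hnil.eq]
    · refine hs.mem_verts_of_mem_edges (v := a.reverse.snd) (ha.edges_mem _ ?_)
      have := Walk.mk_start_snd_mem_edges hnil
      simpa using this
  obtain ⟨i, hi, rfl | rfl⟩ := hm s (hmem p hp) t (hmem p' hp') hst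
  · exact hs.not_mates_of_reach hE0 hE harc hφ htri hC4 hi p p' hp hp' hst
  · exact hs.not_mates_of_reach hE0 hE harc hφ htri hC4 hi p' p hp' hp hst.symm

end Spider

end Spider

/-! ### Girth and degrees -/

theorem not_triangle (hg : 5 ≤ G.egirth) (a b c : V) (hab : G.Adj a b) (hbc : G.Adj b c)
    (hca : G.Adj c a) : False := by
  have h := le_egirth.1 hg a (Walk.cons hab (Walk.cons hbc (Walk.cons hca Walk.nil))) (by
    rw [Walk.isCycle_def, Walk.isTrail_def]
    have := hab.ne; have := hbc.ne; have := hca.ne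
    refine ⟨?_, by simp, ?_⟩
    · simp; tauto
    · simp; tauto)
  simp at h
  norm_cast at h

theorem not_fourCycle (hg : 5 ≤ G.egirth) (a b c d : V) (hac : a ≠ c) (hbd : b ≠ d)
    (hab : G.Adj a b) (hbc : G.Adj b c) (hcd : G.Adj c d) (hda : G.Adj d a) : False := by
  have h := le_egirth.1 hg a (Walk.cons hab (Walk.cons hbc (Walk.cons hcd
      (Walk.cons hda Walk.nil)))) (by
    rw [Walk.isCycle_def, Walk.isTrail_def]
    have := hab.ne; have := hbc.ne; have := hcd.ne; have := hda.ne
    refine ⟨?_, by simp, ?_⟩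
    · simp; tauto
    · simp; tauto)
  simp at h
  norm_cast at h

theorem eq_of_degree_le [Fintype V] [DecidableRel G.Adj] {v : V} (A : Finset V)
    (hA : ∀ a ∈ A, G.Adj v a) (hd : G.degree v ≤ A.card + 1) {u u' : V} (hu : G.Adj v u)
    (hu' : G.Adj v u') (hn : u ∉ A) (hn' : u' ∉ A) : u = u' := by
  classical
  by_contra hne
  have hsub : insert u (insert u' A) ⊆ G.neighborFinset v := by
    intro x hx
    rw [Finset.mem_insert, Finset.mem_insert] at hx
    rw [mem_neighborFinset]
    rcases hx with rfl | rfl | hx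
    exacts [hu, hu', hA x hx]
  have := Finset.card_le_card hsub
  rw [card_neighborFinset_eq_degree, Finset.card_insert_of_notMem (by simp [hne, hn]),
    Finset.card_insert_of_notMem hn'] at this
  omega

theorem eq_of_degree_two [Fintype V] [DecidableRel G.Adj] {v a u u' : V} (hd : G.degree v ≤ 2)
    (ha : G.Adj v a) (hu : G.Adj v u) (hu' : G.Adj v u') (h : u ≠ a) (h' : u' ≠ a) : u = u' :=
  eq_of_degree_le {a} (by simpa) (by simpa) hu hu' (by simpa) (by simpa)

theorem eq_of_degree_three [Fintype V] [DecidableRel G.Adj] {v a b u u' : V}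
    (hd : G.degree v ≤ 3) (hab : a ≠ b) (ha : G.Adj v a) (hb : G.Adj v b) (hu : G.Adj v u)
    (hu' : G.Adj v u') (h1 : u ≠ a) (h1' : u' ≠ a) (h2 : u ≠ b) (h2' : u' ≠ b) : u = u' := by
  classical
  refine eq_of_degree_le {a, b} ?_ ?_ hu hu' ?_ ?_
  · intro x hx
    rw [Finset.mem_insert, Finset.mem_singleton] at hx
    rcases hx with rfl | rfl <;> assumption
  · rwa [Finset.card_pair hab]
  all_goals simp_all

/-! ### Walks avoiding a set, and geodesics -/

/-- There is a walk of length `n` from `u` to `v` avoiding `X`. -/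
def Reach (G : SimpleGraph V) (X : Set V) (n : ℕ) (u v : V) : Prop :=
  ∃ p : G.Walk u v, p.length = n ∧ ∀ x ∈ p.support, x ∉ X

namespace Reach

variable {X : Set V} {n m : ℕ} {u v w : V}

theorem refl (hu : u ∉ X) : Reach G X 0 u u := ⟨Walk.nil, rfl, by simpa using hu⟩

theorem of_adj (h : G.Adj u v) (hu : u ∉ X) (hv : v ∉ X) : Reach G X 1 u v :=
  ⟨Walk.cons h Walk.nil, rfl, by simp [hu, hv]⟩

theorem trans (h : Reach G X n u v) (h' : Reach G X m v w) : Reach G X (n + m) u w := by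
  obtain ⟨p, hp, hpX⟩ := h
  obtain ⟨q, hq, hqX⟩ := h'
  refine ⟨p.append q, by simp [hp, hq], fun x hx => ?_⟩
  rw [Walk.mem_support_append_iff] at hx
  exact hx.elim (hpX x) (hqX x)

theorem symm (h : Reach G X n u v) : Reach G X n v u := by
  obtain ⟨p, hp, hpX⟩ := h
  exact ⟨p.reverse, by simpa using hp, by simpa using hpX⟩

theorem mono {Y : Set V} (hXY : Y ⊆ X) (h : Reach G X n u v) : Reach G Y n u v := by
  obtain ⟨p, hp, hpX⟩ := h
  exact ⟨p, hp, fun x hx hxY => hpX x hx (hXY hxY)⟩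

theorem of_seq {p : ℕ → V} {a b : ℕ} (hab : a ≤ b)
    (hadj : ∀ m, a ≤ m → m < b → G.Adj (p m) (p (m + 1)))
    (hX : ∀ m, a ≤ m → m ≤ b → p m ∉ X) : Reach G X (b - a) (p a) (p b) := by
  induction b, hab using Nat.le_induction with
  | base => simpa using refl (hX a le_rfl le_rfl)
  | succ b hab ih =>
    have h1 := ih (fun m h h' => hadj m h (by omega)) (fun m h h' => hX m h (by omega))
    have h2 := of_adj (hadj b hab (by omega)) (hX b hab (by omega)) (hX (b + 1) (by omega) le_rfl)
    have := h1.trans h2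
    rwa [show b - a + 1 = b + 1 - a by omega] at this

end Reach

/-- `p 0, …, p D` is a shortest walk in the graph `G - X`. -/
structure Geo (G : SimpleGraph V) (X : Set V) (D : ℕ) (p : ℕ → V) : Prop where
  adj : ∀ m < D, G.Adj (p m) (p (m + 1))
  notMem : ∀ m ≤ D, p m ∉ X
  short : ∀ k, Reach G X k (p 0) (p D) → D ≤ k

namespace Geo

variable {X : Set V} {D : ℕ} {p : ℕ → V}

theorem reach (h : Geo G X D p) {a b : ℕ} (hab : a ≤ b) (hb : b ≤ D) :
    Reach G X (b - a) (p a) (p b) :=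
  .of_seq hab (fun m _ hm => h.adj m (by omega)) (fun m _ hm => h.notMem m (by omega))

theorem le_add (h : Geo G X D p) {a b k : ℕ} (hab : a ≤ b) (hb : b ≤ D)
    (hk : Reach G X k (p a) (p b)) : b ≤ a + k := by
  have := h.short _ (((h.reach (Nat.zero_le a) (by omega)).trans hk).trans (h.reach hb le_rfl))
  omega

theorem inj (h : Geo G X D p) {a b : ℕ} (ha : a ≤ D) (hb : b ≤ D) (hab : p a = p b) : a = b := by
  have key : ∀ {a b : ℕ}, a ≤ b → b ≤ D → p a = p b → b ≤ a := by
    intro a b hab hb he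
    have := h.le_add hab hb (k := 0) (he ▸ Reach.refl (h.notMem a (by omega)))
    omega
  rcases le_total a b with hle | hle
  · exact le_antisymm hle (key hle hb hab)
  · exact le_antisymm (key hle ha hab.symm) hle

theorem eq_succ_of_adj (h : Geo G X D p) {a b : ℕ} (hab : a < b) (hb : b ≤ D)
    (hadj : G.Adj (p a) (p b)) : b = a + 1 := by
  have := h.le_add hab.le hb (.of_adj hadj (h.notMem a (by omega)) (h.notMem b hb))
  omega

/-- The detour through `f` forces `b ≤ a + 2`, and then it closes a triangle or a four-cycle. -/
theorem no_common (h : Geo G X D p) (hg : 5 ≤ G.egirth) {a b : ℕ} (hab : a < b) (hb : b ≤ D)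
    {f : V} (hf : f ∉ X) (hfp : ∀ m ≤ D, f ≠ p m) (h1 : G.Adj f (p a)) (h2 : G.Adj f (p b)) :
    False := by
  have h3 := h.le_add hab.le hb ((Reach.of_adj h1.symm (h.notMem a (by omega)) hf).trans
    (Reach.of_adj h2 hf (h.notMem b hb)))
  obtain rfl | rfl : b = a + 1 ∨ b = a + 2 := by omega
  · exact not_triangle hg _ _ _ h1 (h.adj a (by omega)) h2.symm
  · exact not_fourCycle hg _ _ _ _ (hfp (a + 1) (by omega)) (fun h' => by
      have := h.inj (by omega) hb h'; omega) h1 (h.adj a (by omega)) (h.adj (a + 1) (by omega))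
      h2.symm

end Geo

theorem Reach.exists_geo {X : Set V} {n : ℕ} {u v : V} (h : Reach G X n u v) :
    ∃ D ≤ n, ∃ p : ℕ → V, Geo G X D p ∧ p 0 = u ∧ p D = v := by
  classical
  have hex : ∃ n, Reach G X n u v := ⟨n, h⟩
  obtain ⟨p, hp, hpX⟩ := Nat.find_spec hex
  refine ⟨Nat.find hex, Nat.find_min' hex h, p.getVert, ⟨?_, ?_, ?_⟩, by simp, ?_⟩
  · intro m hm
    exact p.adj_getVert_succ (by omega)
  · intro m hm
    exact hpX _ (p.getVert_mem_support m)
  · intro k hk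
    rw [← hp, Walk.getVert_length, Walk.getVert_zero] at hk
    exact Nat.find_min' hex hk
  · rw [← hp, Walk.getVert_length]

/-! ### Paths between vertices of degree two -/

/-- A path whose inner vertices have degree at most three and whose ends have degree at
most two. -/
structure TwoPath [Fintype V] (G : SimpleGraph V) [DecidableRel G.Adj] (L : ℕ) (Q : ℕ → V) :
    Prop where
  pos : 1 ≤ L
  adj : ∀ m < L, G.Adj (Q m) (Q (m + 1))
  inj : ∀ a b, a ≤ L → b ≤ L → Q a = Q b → a = b
  degree_zero : G.degree (Q 0) ≤ 2
  degree_last : G.degree (Q L) ≤ 2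
  degree_mid : ∀ m, 0 < m → m < L → G.degree (Q m) ≤ 3

/-- The vertices of the path `Q 0, …, Q L`. -/
def pathVerts (L : ℕ) (Q : ℕ → V) : Set V := {v | ∃ m ≤ L, v = Q m}

/-- The edges of the path `Q 0, …, Q L`. -/
def pathEdges (L : ℕ) (Q : ℕ → V) : Set (Sym2 V) := {e | ∃ m < L, e = s(Q m, Q (m + 1))}

namespace TwoPath

variable [Fintype V] [DecidableRel G.Adj] {L : ℕ} {Q : ℕ → V}

theorem outer (h : TwoPath G L Q) : ∀ s ∈ pathVerts L Q, ∀ u u', G.Adj s u →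
    s(s, u) ∉ pathEdges L Q → G.Adj s u' → s(s, u') ∉ pathEdges L Q → u = u' := by
  rintro _ ⟨m, hm, rfl⟩ u u' hu hnu hu' hnu'
  have up : ∀ x, s(Q m, x) ∉ pathEdges L Q → m < L → x ≠ Q (m + 1) := by
    rintro _ hx hm rfl
    exact hx ⟨m, hm, rfl⟩
  have dn : ∀ x n, s(Q m, x) ∉ pathEdges L Q → m = n + 1 → x ≠ Q n := by
    rintro _ n hx rfl rfl
    exact hx ⟨n, by omega, Sym2.eq_swap⟩
  have hp := h.pos
  rcases m.eq_zero_or_pos with rfl | h0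
  · exact eq_of_degree_two h.degree_zero (h.adj 0 hp) hu hu' (up _ hnu hp) (up _ hnu' hp)
  obtain ⟨n, rfl⟩ : ∃ n, m = n + 1 := ⟨m - 1, by omega⟩
  rcases hm.lt_or_eq with hm | rfl
  · refine eq_of_degree_three (h.degree_mid _ h0 hm) ?_ (h.adj _ hm) (h.adj n (by omega)).symm hu
      hu' (up _ hnu hm) (up _ hnu' hm) (dn _ _ hnu rfl) (dn _ _ hnu' rfl)
    intro he
    have := h.inj _ _ (by omega) (by omega) he
    omega
  · exact eq_of_degree_two h.degree_last (h.adj n (by omega)).symm hu hu' (dn _ _ hnu rfl)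
      (dn _ _ hnu' rfl)

theorem three_le_of_mates (h : TwoPath G L Q) (hg : 5 ≤ G.egirth) {a b : ℕ} (hab : a < b)
    (hb : b ≤ L) (hm : Mates G (pathVerts L Q) (pathEdges L Q) (Q a) (Q b)) : a + 3 ≤ b := by
  by_contra hlt
  obtain rfl | rfl : b = a + 1 ∨ b = a + 2 := by omega
  · obtain ⟨-, ⟨-, h1⟩ | ⟨f, -, h1, h2⟩⟩ := hm
    · exact h1 ⟨a, by omega, rfl⟩
    · exact not_triangle hg _ _ _ h1 (h.adj a (by omega)) h2.symm
  · have h3 := h.adj a (by omega)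
    have h4 := h.adj (a + 1) (by omega)
    obtain ⟨hne, ⟨h1, -⟩ | ⟨f, hf, h1, h2⟩⟩ := hm
    · exact not_triangle hg _ _ _ h1 h4.symm h3.symm
    · refine not_fourCycle hg _ _ _ _ ?_ hne h1 h3 h4 h2.symm
      rintro rfl
      exact hf ⟨a + 1, by omega, rfl⟩

/-- The path is a spider with a single leg and axis `Q L`. Arcs join distinct legs, so there are
none. -/
theorem not_isCritical (h : TwoPath G L Q) (hg : 5 ≤ G.egirth)
    (hm : ∀ a b, a < b → b ≤ L → Mates G (pathVerts L Q) (pathEdges L Q) (Q a) (Q b) → a = 0) :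
    ¬ IsCritical G := by
  intro hcrit
  have hp := h.pos
  have hV : spiderVerts (Q L) (fun _ : Unit => L) (fun _ => Q) = pathVerts L Q := by
    ext v
    constructor
    · rintro (rfl | ⟨_, m, h1, rfl⟩)
      · exact ⟨L, le_rfl, rfl⟩
      · exact ⟨m, le_of_lt h1, rfl⟩
    · rintro ⟨m, hm, rfl⟩
      rcases hm.lt_or_eq with hm | rfl
      · exact Or.inr ⟨(), m, hm, rfl⟩
      · exact Or.inl rfl
  have hE : spiderEdges (fun _ : Unit => L) (fun _ => Q) = pathEdges L Q := by
    ext e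
    simp [spiderEdges, pathEdges]
  have hs : Spider G (Q L) (fun _ : Unit => L) (fun _ => Q) (fun _ => 2 ≤ L) := by
    refine ⟨fun _ => hp, fun _ => rfl, fun _ => h.adj, ?_, ?_, ?_, ?_, fun _ => id, ?_, ?_, ?_⟩
    · intro _ m hm he
      have := h.inj _ _ hm.le le_rfl he
      omega
    · intro _ _ m n hm hn he
      exact Or.inl ⟨rfl, h.inj _ _ hm.le hn.le he⟩
    · rw [hV, hE]; exact h.outer
    · intro i j hij; exact absurd rfl hij
    · intro i j hij; exact absurd rfl hij
    · intro i j hij; exact absurd rfl hij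
    · intro i h1 h2; exact absurd h2 h1
  obtain ⟨i, hi⟩ := hs.exists_transGen_arc hcrit (not_triangle hg) (not_fourCycle hg) (by
    rw [hV, hE]
    rintro _ ⟨a, ha, rfl⟩ _ ⟨b, hb, rfl⟩ hab
    rcases lt_trichotomy a b with hlt | rfl | hlt
    · have := h.three_le_of_mates hg hlt hb hab
      exact ⟨(), by omega, Or.inl (by rw [hm a b hlt hb hab])⟩
    · exact absurd rfl hab.1
    · have := h.three_le_of_mates hg hlt ha hab.symm
      exact ⟨(), by omega, Or.inr (by rw [hm b a hlt ha hab.symm])⟩)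
  obtain ⟨j, hj, -⟩ := Relation.TransGen.head'_iff.1 hi
  exact hj.1 rfl

end TwoPath

theorem transGen_bool {R : Bool → Bool → Prop} (hirr : ∀ i, ¬ R i i) {i : Bool}
    (h : Relation.TransGen R i i) : R true false ∧ R false true := by
  obtain ⟨j, hij, hj⟩ := Relation.TransGen.head'_iff.1 h
  have hne : j ≠ i := by rintro rfl; exact hirr _ hij
  obtain ⟨k, hjk, -⟩ := (Relation.reflTransGen_iff_eq_or_transGen.1 hj).elim
    (fun h => absurd h.symm hne) Relation.TransGen.head'_iff.1
  have hne' : k ≠ j := by rintro rfl; exact hirr _ hjk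
  revert hij hjk hne hne'
  cases i <;> cases j <;> cases k <;> simp <;> tauto

namespace TwoPath

variable [Fintype V] [DecidableRel G.Adj] {L : ℕ} {Q : ℕ → V}

/-- With an inner vertex as axis, the path is a spider with two legs and unshared tips. A directed
cycle needs an arc each way, and then both legs have length 2. -/
theorem exceptional (h : TwoPath G L Q) (hg : 5 ≤ G.egirth) (hcrit : IsCritical G) (hL : 2 ≤ L)
    (hm : ∀ a b, a < b → b ≤ L → Mates G (pathVerts L Q) (pathEdges L Q) (Q a) (Q b) →
      a = 0 ∨ b = L) :
    L = 4 ∧ Mates G (pathVerts L Q) (pathEdges L Q) (Q 0) (Q 3) ∧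
      Mates G (pathVerts L Q) (pathEdges L Q) (Q 1) (Q 4) := by
  -- For `L ≠ 4` the leg from `Q 0` gets length 3 or 1, so that no arc leaves it. It is not low when
  -- `L ≤ 3`, but mates are at least 3 apart on the path, so the only possible pair then involves `Q
  -- L`, the tip of the other leg, which is low.
  obtain ⟨c, hc⟩ : ∃ c, c = if 5 ≤ L then 3 else if L ≤ 3 then 1 else 2 := ⟨_, rfl⟩
  have hc1 : 1 ≤ c := by split_ifs at hc <;> omega
  have hcL : c < L := by split_ifs at hc <;> omega
  let l : Bool → ℕ := fun b => cond b c (L - c)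
  let q : Bool → ℕ → V := fun b n => cond b (Q n) (Q (L - n))
  have hV : spiderVerts (Q c) l q = pathVerts L Q := by
    ext v
    constructor
    · rintro (rfl | ⟨_ | _, m, hm, rfl⟩)
      · exact ⟨c, hcL.le, rfl⟩
      · exact ⟨L - m, by omega, rfl⟩
      · exact ⟨m, (hm.trans hcL).le, rfl⟩
    · rintro ⟨m, hm, rfl⟩
      rcases lt_trichotomy m c with hmc | rfl | hmc
      · exact Or.inr ⟨true, m, hmc, rfl⟩
      · exact Or.inl rfl
      · refine Or.inr ⟨false, L - m, show L - m < L - c by omega, ?_⟩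
        change Q m = Q (L - (L - m))
        congr 1; omega
  have hE : spiderEdges l q = pathEdges L Q := by
    ext e
    constructor
    · rintro ⟨_ | _, m, hm, rfl⟩
      · change m < L - c at hm
        refine ⟨L - (m + 1), by omega, ?_⟩
        change s(Q (L - m), Q (L - (m + 1))) = _
        rw [Sym2.eq_swap]
        congr 3; omega
      · change m < c at hm
        exact ⟨m, by omega, rfl⟩
    · rintro ⟨m, hm, rfl⟩
      rcases Nat.lt_or_ge m c with hmc | hmc
      · exact ⟨true, m, hmc, rfl⟩
      · refine ⟨false, L - (m + 1), show L - (m + 1) < L - c by omega, ?_⟩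
        change _ = s(Q (L - (L - (m + 1))), Q (L - (L - (m + 1) + 1)))
        rw [Sym2.eq_swap, show L - (L - (m + 1)) = m + 1 by omega,
          show L - (L - (m + 1) + 1) = m by omega]
  have hs : Spider G (Q c) l q (fun b => 2 ≤ l b) := by
    have hshare : ∀ i j, i ≠ j → q i 0 ≠ q j 0 := by
      rintro (_ | _) (_ | _) hij he
      · exact hij rfl
      · have := h.inj _ _ (by omega) (by omega) he; omega
      · have := h.inj _ _ (by omega) (by omega) he; omega
      · exact hij rfl
    refine ⟨?_, ?_, ?_, ?_, ?_, ?_, fun i j hij he => absurd he (hshare i j hij), fun _ => id,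
      fun i j hij he => absurd he (hshare i j hij), fun i j hij he => absurd he (hshare i j hij),
      fun i h1 h2 => absurd h2 h1⟩
    · rintro (_ | _)
      · change 1 ≤ L - c; omega
      · exact hc1
    · rintro (_ | _)
      · change Q (L - (L - c)) = Q c; congr 1; omega
      · rfl
    · rintro (_ | _) m hm
      · change m < L - c at hm
        change G.Adj (Q (L - m)) (Q (L - (m + 1)))
        have := h.adj (L - (m + 1)) (by omega)
        rw [show L - (m + 1) + 1 = L - m by omega] at this
        exact this.symm
      · exact h.adj m (hm.trans hcL)
    · rintro (_ | _) m hm he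
      · change m < L - c at hm
        have := h.inj _ _ (by omega) (by omega) he; omega
      · change m < c at hm
        have := h.inj _ _ (by omega) (by omega) he; omega
    · rintro (_ | _) (_ | _) m n hm hn he
      · change m < L - c at hm; change n < L - c at hn
        have := h.inj _ _ (by omega) (by omega) he; left; exact ⟨rfl, by omega⟩
      · change m < L - c at hm; change n < c at hn
        have := h.inj _ _ (by omega) (by omega) he; omega
      · change m < c at hm; change n < L - c at hn
        have := h.inj _ _ (by omega) (by omega) he; omega
      · change m < c at hm; change n < c at hn
        have := h.inj _ _ (by omega) (by omega) he; left; exact ⟨rfl, by omega⟩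
    · rw [hV, hE]; exact h.outer
  have hlow : ∀ a b, a < b → b ≤ L → Mates G (pathVerts L Q) (pathEdges L Q) (Q a) (Q b) →
      (2 ≤ l true ∧ a = 0) ∨ (2 ≤ l false ∧ b = L) := by
    intro a b hab hb hmab
    have h3 := h.three_le_of_mates hg hab hb hmab
    have h4 := hm a b hab hb hmab
    change (2 ≤ c ∧ a = 0) ∨ (2 ≤ L - c ∧ b = L)
    split_ifs at hc <;> omega
  obtain ⟨i, hi⟩ := hs.exists_transGen_arc hcrit (not_triangle hg) (not_fourCycle hg) (by
    rw [hV, hE]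
    rintro _ ⟨a, ha, rfl⟩ _ ⟨b, hb, rfl⟩ hab
    rcases lt_trichotomy a b with hlt | rfl | hlt
    · rcases hlow a b hlt hb hab with ⟨h1, rfl⟩ | ⟨h1, rfl⟩
      · exact ⟨true, h1, Or.inl rfl⟩
      · exact ⟨false, h1, Or.inr rfl⟩
    · exact absurd rfl hab.1
    · rcases hlow b a hlt ha hab.symm with ⟨h1, rfl⟩ | ⟨h1, rfl⟩
      · exact ⟨true, h1, Or.inr rfl⟩
      · exact ⟨false, h1, Or.inl rfl⟩)
  obtain ⟨h1, h2⟩ := transGen_bool (fun i h => h.1 rfl) hi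
  have hL0 : Q 0 ≠ Q L := fun he => by have := h.inj _ _ (by omega) le_rfl he; omega
  have h1' := h1.2.resolve_right fun h => hL0 h.1
  have h2' := h2.2.resolve_right fun h => hL0 h.1.symm
  rw [hV, hE] at h1' h2'
  obtain ⟨-, hc2, n, hn, hn0, hmn⟩ := h1'
  obtain ⟨-, hc2', n', hn', hn0', hmn'⟩ := h2'
  change c = 2 at hc2
  change L - c = 2 at hc2'
  change n < L - c at hn
  change n' < c at hn'
  change ¬ (2 ≤ L - c ∧ n = 0) at hn0
  change ¬ (2 ≤ c ∧ n' = 0) at hn0'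
  obtain rfl : L = 4 := by omega
  obtain rfl : n = 1 := by omega
  obtain rfl : n' = 1 := by omega
  exact ⟨rfl, hmn, hmn'.symm⟩

end TwoPath

/-! ### Cycles through a vertex of degree two -/

/-- The cycle is a spider with axis `p 0` and two legs sharing the tip `x`: the edge from `x` to `p
0`, and the low leg going round the other way. As `p` is a geodesic, there are no mates at all. -/
theorem Geo.not_isCritical_of_cycle [Fintype V] [DecidableRel G.Adj] {D : ℕ} {p : ℕ → V} {x : V}
    (h : Geo G {x} D p) (hg : 5 ≤ G.egirth) (hD : 1 ≤ D) (hx : G.degree x ≤ 2)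
    (h0 : G.Adj x (p 0)) (hxD : G.Adj x (p D)) (hdeg : ∀ m ≤ D, G.degree (p m) ≤ 3) :
    ¬ IsCritical G := by
  intro hcrit
  have hD2 : 2 ≤ D := by
    by_contra hlt
    obtain rfl : D = 1 := by omega
    exact not_triangle hg _ _ _ h0 (h.adj 0 (by omega)) hxD.symm
  have hpx : ∀ m ≤ D, p m ≠ x := fun m hm => h.notMem m hm
  let l : Bool → ℕ := fun b => cond b 1 (D + 1)
  let q : Bool → ℕ → V := fun b n => if n = 0 then x else cond b (p 0) (p (D + 1 - n))
  have q0 : ∀ b, q b 0 = x := fun b => rfl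
  have qf : ∀ n, n ≠ 0 → q false n = p (D + 1 - n) := fun n hn => by simp [q, hn]
  have q1 : q false 1 = p D := qf 1 one_ne_zero
  have qt : q true 1 = p 0 := by simp [q]
  have hV : ∀ v, v ∈ spiderVerts (p 0) l q → v = x ∨ ∃ m ≤ D, v = p m := by
    rintro v (rfl | ⟨_ | _, m, hm, rfl⟩)
    · exact Or.inr ⟨0, by omega, rfl⟩
    · by_cases hm0 : m = 0
      · subst hm0; exact Or.inl rfl
      · exact Or.inr ⟨D + 1 - m, by omega, qf m hm0⟩
    · change m < 1 at hm
      obtain rfl : m = 0 := by omega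
      exact Or.inl rfl
  have hpV : ∀ m ≤ D, p m ∈ spiderVerts (p 0) l q := by
    intro m hm
    rcases m.eq_zero_or_pos with rfl | h0
    · exact Or.inl rfl
    · refine Or.inr ⟨false, D + 1 - m, show D + 1 - m < D + 1 by omega, ?_⟩
      rw [qf _ (by omega)]
      congr 1; omega
  have hEx0 : s(x, p 0) ∈ spiderEdges l q := ⟨true, 0, show 0 < 1 by omega, by rw [qt, q0]⟩
  have hExD : s(x, p D) ∈ spiderEdges l q :=
    ⟨false, 0, show 0 < D + 1 by omega, by rw [q1, q0]⟩
  have hEp : ∀ m < D, s(p m, p (m + 1)) ∈ spiderEdges l q := by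
    intro m hm
    refine ⟨false, D - m, show D - m < D + 1 by omega, ?_⟩
    rw [qf _ (by omega), qf _ (by omega), Sym2.eq_swap, show D + 1 - (D - m) = m + 1 by omega,
      show D + 1 - (D - m + 1) = m by omega]
  have hEx : ∀ u, G.Adj x u → s(x, u) ∈ spiderEdges l q := by
    intro u hu
    by_contra hnu
    have hne0 : u ≠ p 0 := by rintro rfl; exact hnu hEx0
    have hneD : u ≠ p D := by rintro rfl; exact hnu hExD
    refine hneD (eq_of_degree_two hx h0 hu hxD hne0 ?_)
    intro he
    have := h.inj le_rfl (by omega) he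
    omega
  have hs : Spider G (p 0) l q (fun b => b = false) := by
    refine ⟨?_, ?_, ?_, ?_, ?_, ?_, ?_, ?_, ?_, ?_, ?_⟩
    · rintro (_ | _)
      · change 1 ≤ D + 1; omega
      · exact le_rfl
    · rintro (_ | _)
      · change q false (D + 1) = _
        rw [qf _ (by omega)]; simp
      · exact qt
    · rintro (_ | _) m hm
      · change m < D + 1 at hm
        by_cases hm0 : m = 0
        · subst hm0
          rw [q0, q1]; exact hxD
        · rw [qf _ hm0, qf _ (by omega)]
          have := h.adj (D + 1 - (m + 1)) (by omega)
          rw [show D + 1 - (m + 1) + 1 = D + 1 - m by omega] at this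
          exact this.symm
      · change m < 1 at hm
        obtain rfl : m = 0 := by omega
        rw [qt]; exact h0
    · rintro (_ | _) m hm he
      · change m < D + 1 at hm
        by_cases hm0 : m = 0
        · subst hm0
          exact hpx 0 (by omega) he.symm
        · rw [qf _ hm0] at he
          have := h.inj (by omega) (by omega) he; omega
      · change m < 1 at hm
        obtain rfl : m = 0 := by omega
        exact hpx 0 (by omega) he.symm
    · rintro i j m n hm hn he
      have key : ∀ i m, m < l i → m ≠ 0 → i = false ∧ m ≤ D := by
        rintro (_ | _) m hm h0
        · change m < D + 1 at hm; exact ⟨rfl, by omega⟩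
        · change m < 1 at hm; omega
      by_cases hm0 : m = 0 <;> by_cases hn0 : n = 0
      · exact Or.inr ⟨hm0, hn0⟩
      · obtain ⟨rfl, h1⟩ := key j n hn hn0
        rw [hm0, qf _ hn0] at he
        exact absurd he.symm (hpx _ (by omega))
      · obtain ⟨rfl, h1⟩ := key i m hm hm0
        rw [hn0, qf _ hm0] at he
        exact absurd he (hpx _ (by omega))
      · obtain ⟨rfl, h1⟩ := key j n hn hn0
        obtain ⟨rfl, h2⟩ := key i m hm hm0
        rw [qf _ hn0, qf _ hm0] at he
        have := h.inj (by omega) (by omega) he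
        exact Or.inl ⟨rfl, by omega⟩
    · intro s hs u u' hu hnu hu' hnu'
      rcases hV s hs with rfl | ⟨m, hm, rfl⟩
      · exact absurd (hEx u hu) hnu
      have up : ∀ z, s(p m, z) ∉ spiderEdges l q → m < D → z ≠ p (m + 1) := by
        rintro _ hz hm rfl; exact hz (hEp m hm)
      have dn : ∀ z n, s(p m, z) ∉ spiderEdges l q → m = n + 1 → z ≠ p n := by
        rintro _ n hz rfl rfl
        exact hz (Sym2.eq_swap ▸ hEp n (by omega))
      rcases m.eq_zero_or_pos with rfl | hpos
      · have hz : ∀ z, s(p 0, z) ∉ spiderEdges l q → z ≠ x := by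
          rintro _ hz rfl; exact hz (Sym2.eq_swap ▸ hEx0)
        exact eq_of_degree_three (hdeg 0 hm) (hpx 1 (by omega)).symm h0.symm
          (h.adj 0 (by omega)) hu hu' (hz u hnu) (hz u' hnu') (up u hnu (by omega))
          (up u' hnu' (by omega))
      obtain ⟨n, rfl⟩ : ∃ n, m = n + 1 := ⟨m - 1, by omega⟩
      rcases hm.lt_or_eq with hm' | rfl
      · refine eq_of_degree_three (hdeg _ hm) ?_ (h.adj _ hm') (h.adj n (by omega)).symm hu hu'
          (up u hnu hm') (up u' hnu' hm') (dn u n hnu rfl) (dn u' n hnu' rfl)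
        intro he
        have := h.inj (by omega) (by omega) he; omega
      · have hz : ∀ z, s(p (n + 1), z) ∉ spiderEdges l q → z ≠ x := by
          rintro _ hz rfl; exact hz (Sym2.eq_swap ▸ hExD)
        exact eq_of_degree_three (hdeg _ hm) (hpx n (by omega)).symm hxD.symm
          (h.adj n (by omega)).symm hu hu' (hz u hnu) (hz u' hnu') (dn u n hnu rfl)
          (dn u' n hnu' rfl)
    · intro i j _ _ u hu
      exact hEx u hu
    · rintro _ rfl
      change 2 ≤ D + 1; omega
    · intro i j hij _
      cases i <;> cases j <;> simp at hij ⊢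
    · rintro _ j _ _ rfl
      change 3 ≤ D + 1; omega
    · rintro (_ | _) h1 h2
      · exact absurd rfl h1
      · exact ⟨false, by simp, rfl⟩
  obtain ⟨i, hi⟩ := hs.exists_transGen_arc hcrit (not_triangle hg) (not_fourCycle hg) (by
    have hx' : ∀ t, ¬ Mates G (spiderVerts (p 0) l q) (spiderEdges l q) x t := by
      rintro t ⟨-, ⟨h1, h2⟩ | ⟨f, hf, h1, h2⟩⟩
      · exact h2 (hEx t h1)
      · have := hEx f h1.symm
        rw [Sym2.eq_swap] at this
        exact hf (hs.mem_verts_of_mem_edges this)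
    have hp' : ∀ a b, a < b → b ≤ D →
        ¬ Mates G (spiderVerts (p 0) l q) (spiderEdges l q) (p a) (p b) := by
      rintro a b hab hb ⟨-, ⟨h1, h2⟩ | ⟨f, hf, h1, h2⟩⟩
      · obtain rfl := h.eq_succ_of_adj hab hb h1
        exact h2 (hEp a (by omega))
      · refine h.no_common hg hab hb (f := f) ?_ ?_ h1 h2
        · rintro rfl
          exact hf (Or.inr ⟨true, 0, show 0 < 1 by omega, rfl⟩)
        · rintro m hm rfl
          exact hf (hpV m hm)
    intro s hs t ht hst
    exfalso
    rcases hV s hs with rfl | ⟨a, ha, rfl⟩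
    · exact hx' t hst
    rcases hV t ht with rfl | ⟨b, hb, rfl⟩
    · exact hx' _ hst.symm
    rcases lt_trichotomy a b with hlt | rfl | hlt
    · exact hp' a b hlt hb hst
    · exact hst.1 rfl
    · exact hp' b a hlt ha hst.symm)
  -- An arc leaving the long leg would need its length `D + 1` to be 2 or 1, but `D ≥ 2`.
  obtain ⟨-, -, h2⟩ := transGen_bool (fun i h => h.1 rfl) hi
  rcases h2 with ⟨-, h2, -⟩ | ⟨-, h2⟩
  · change D + 1 = 2 at h2; omega
  · change D + 1 = 1 at h2; omega

/-! ### Sails -/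

theorem exists_path_of_seq {p : ℕ → V} {D : ℕ} (hadj : ∀ m < D, G.Adj (p m) (p (m + 1)))
    (hinj : ∀ a b, a ≤ D → b ≤ D → p a = p b → a = b) :
    ∃ w : G.Walk (p 0) (p D), w.IsPath ∧ w.length = D ∧ ∀ v ∈ w.support, ∃ m ≤ D, v = p m := by
  induction D with
  | zero => exact ⟨Walk.nil, by simp, rfl, by simp⟩
  | succ D ih =>
    obtain ⟨w, h1, h2, h3⟩ := ih (fun m hm => hadj m (by omega))
      (fun a b ha hb => hinj a b (by omega) (by omega))
    refine ⟨w.concat (hadj D (by omega)), ?_, by simp [h2], ?_⟩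
    · rw [Walk.concat_isPath_iff]
      refine ⟨h1, fun hmem => ?_⟩
      obtain ⟨m, hm, he⟩ := h3 _ hmem
      have := hinj _ _ le_rfl (by omega) he
      omega
    · intro v hv
      rw [Walk.support_concat, List.mem_append] at hv
      rcases hv with hv | hv
      · obtain ⟨m, hm, he⟩ := h3 _ hv
        exact ⟨m, by omega, he⟩
      · exact ⟨D + 1, le_rfl, by simpa using hv⟩

theorem Reach.exists_deleteEdges {x u v : V} {k : ℕ} (h : Reach G {x} k u v) :
    ∃ w : (G.deleteEdges {s(x, u)}).Walk u v, w.length = k := by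
  obtain ⟨p, hp, hpX⟩ := h
  refine ⟨p.toDeleteEdges _ ?_, by simp [hp]⟩
  rintro e he rfl
  exact hpX x (p.fst_mem_support_of_mem_edges he) rfl

section Sails

variable [Fintype V] [DecidableRel G.Adj]

/-- A vertex of degree at most one would be a spider without legs, hence without arcs. -/
theorem IsCritical.two_le_degree (hcrit : IsCritical G) (hg : 5 ≤ G.egirth) (v : V) :
    2 ≤ G.degree v := by
  by_contra hlt
  have hV : ∀ s, s ∈ spiderVerts v (fun i : Empty => i.elim) (fun i => i.elim) → s = v := by
    rintro s (rfl | ⟨i, -⟩)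
    · rfl
    · exact i.elim
  have hs : Spider G v (fun i : Empty => i.elim) (fun i => i.elim) (fun i => i.elim) := by
    refine ⟨fun i => i.elim, fun i => i.elim, fun i => i.elim, fun i => i.elim, fun i => i.elim,
      ?_, fun i => i.elim, fun i => i.elim, fun i => i.elim, fun i => i.elim, fun i => i.elim⟩
    intro s hs u u' hu _ hu' _
    obtain rfl := hV s hs
    exact eq_of_degree_le ∅ (by simp) (by simp; omega) hu hu' (by simp) (by simp)
  obtain ⟨i, -⟩ := hs.exists_transGen_arc hcrit (not_triangle hg) (not_fourCycle hg) (by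
    intro s hs t ht hst
    exact absurd ((hV s hs).trans (hV t ht).symm) hst.1)
  exact i.elim

/-- The sequence `a, p 0, p 1, …`. -/
def consSeq (a : V) (p : ℕ → V) : ℕ → V
  | 0 => a
  | n + 1 => p n

/-- The sequence `p 0, …, p D, a, a, …`. -/
def snocSeq (D : ℕ) (p : ℕ → V) (a : V) : ℕ → V := fun m => if m ≤ D then p m else a

/-- Once the edge `x u` is deleted, `x` has at most one neighbour, so a path not ending in `x`
cannot pass through it. This lets distances in `G - x u` be computed in `G - x`. -/
theorem reach_of_deleteEdges {x u v : V} (hx : G.degree x ≤ 2) (hxu : G.Adj x u) (hxv : v ≠ x)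
    (w : (G.deleteEdges {s(x, u)}).Walk u v) (hw : w.IsPath) : Reach G {x} w.length u v := by
  refine ⟨w.mapLe (deleteEdges_le _), by simp, ?_⟩
  rw [Walk.support_mapLe_eq_support]
  rintro _ hz rfl
  obtain ⟨n, hn, hnl⟩ := Walk.mem_support_iff_exists_getVert.1 hz
  have hn0 : n ≠ 0 := by
    rintro rfl
    rw [Walk.getVert_zero] at hn
    exact hxu.ne hn.symm
  have hnl' : n ≠ w.length := by
    rintro rfl
    rw [Walk.getVert_length] at hn
    exact hxv hn
  obtain ⟨m, rfl⟩ : ∃ m, n = m + 1 := ⟨n - 1, by omega⟩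
  have h1 := w.adj_getVert_succ (i := m) (by omega)
  have h2 := w.adj_getVert_succ (i := m + 1) (by omega)
  rw [hn, deleteEdges_adj] at h1 h2
  have h3 : w.getVert m ≠ u := by
    intro h
    rw [h, Sym2.eq_swap] at h1
    exact h1.2 rfl
  have h4 : w.getVert (m + 1 + 1) ≠ u := by
    intro h
    rw [h] at h2
    exact h2.2 rfl
  have := eq_of_degree_two hx hxu h1.1.symm h2.1 h3 h4
  have := hw.getVert_injOn (by simp; omega) (by simp; omega) this
  omega

/-- The data of a sail `q 0, …, q l`, with the shortest-path conditions expressed in `G - q 0`. -/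
structure SailSeq (G : SimpleGraph V) [DecidableRel G.Adj] (l : ℕ) (q : ℕ → V) : Prop where
  pos : 1 ≤ l
  adj_zero : G.Adj (q 0) (q 1)
  geo : Geo G {q 0} (l - 1) (fun m => q (m + 1))
  degree_zero : G.degree (q 0) = 2
  degree_last : 4 ≤ G.degree (q l)
  degree_mid : ∀ m, 0 < m → m < l → G.degree (q m) = 3
  minimal : ∀ D p, Geo G {q 0} D p → p 0 = q 1 → (∀ m < D, G.degree (p m) = 3) →
    4 ≤ G.degree (p D) → l ≤ D + 1

theorem IsSail.sailSeq {x y : V} {P : G.Walk x y} (h : IsSail G P) :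
    SailSeq G P.length P.getVert := by
  obtain ⟨⟨hP, hlen, hint, hshort⟩, hx, hy, hmin⟩ := h
  have hinj : ∀ a b, a ≤ P.length → b ≤ P.length → P.getVert a = P.getVert b → a = b :=
    fun a b ha hb he => hP.getVert_injOn (by simpa) (by simpa) he
  have hadj1 : G.Adj x P.snd := by
    have := P.adj_getVert_succ (i := 0) (by omega)
    simpa using this
  have htail : P.tail.length + 1 = P.length :=
    Walk.length_tail_add_one (by rw [Walk.not_nil_iff_lt_length]; omega)
  refine ⟨hlen, by simpa using hadj1, ⟨?_, ?_, ?_⟩,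
    by rw [Walk.getVert_zero]; exact hx, by rw [Walk.getVert_length]; exact hy, ?_, ?_⟩
  · intro m hm
    exact P.adj_getVert_succ (by omega)
  · intro m hm he
    have := hinj _ _ (by omega) (by omega) he
    omega
  · intro k hk
    rw [Walk.getVert_zero, show P.length - 1 + 1 = P.length by omega, Walk.getVert_length] at hk
    obtain ⟨w, hw⟩ := hk.exists_deleteEdges
    have := dist_le w
    change dist (G.deleteEdges {s(x, P.snd)}) P.snd y ≤ _ at this
    omega
  · intro m h0 hm
    refine hint _ (P.getVert_mem_support m) ?_ ?_
    · intro he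
      have := hinj m 0 (by omega) (by omega) (by simpa using he)
      omega
    · intro he
      have := hinj m P.length (by omega) (by omega) (by simpa using he)
      omega
  · intro D p hp h0 hdeg hD
    rw [Walk.getVert_zero] at hp
    have hpx : ∀ m ≤ D, p m ≠ x := fun m hm => hp.notMem m hm
    obtain ⟨w, hw1, hw2, hw3⟩ := exists_path_of_seq hp.adj (fun a b ha hb => hp.inj ha hb)
    have hxp : G.Adj x (p 0) := by rw [h0]; exact hadj1
    have hsnd : (Walk.cons hxp w).snd = p 0 := by simp
    have := hmin (p D) (Walk.cons hxp w) ⟨?_, by simp, ?_, ?_⟩ hD (by rw [hsnd, h0])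
    · simpa [hw2] using this
    · rw [Walk.cons_isPath_iff]
      refine ⟨hw1, fun hmem => ?_⟩
      obtain ⟨m, hm, he⟩ := hw3 _ hmem
      exact hpx m hm he.symm
    · intro v hv hvx hvy
      rw [Walk.support_cons, List.mem_cons] at hv
      obtain ⟨m, hm, rfl⟩ := hw3 _ (hv.resolve_left hvx)
      refine hdeg m (lt_of_le_of_ne hm ?_)
      rintro rfl
      exact hvy rfl
    · have ht : (Walk.cons hxp w).tail.length = D := by simp [hw2]
      refine ht.trans ?_
      rw [hsnd]
      have hr := hp.reach (Nat.zero_le D) le_rfl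
      obtain ⟨w', hw'⟩ := hr.exists_deleteEdges
      obtain ⟨w'', h1, h2⟩ := w'.reachable.exists_path_of_dist
      have h3 := hp.short _ (reach_of_deleteEdges hx.le hxp (hpx D le_rfl) w'' h1)
      have h4 := dist_le w'
      omega

/-! ### The surroundings of a sail, and the distance between two sails -/

namespace SailSeq

variable {l : ℕ} {q : ℕ → V}

/-- By induction the inner vertices of a geodesic to `v` have degree 3. If `v` had degree 2,
prepending the tip would give a `TwoPath` in which all mates involve the tip. If `v` had degree at
least 4 too early, the sail would not be of minimum length. -/
theorem degree_of_reach (h : SailSeq G l q) (hcrit : IsCritical G) (hg : 5 ≤ G.egirth) {n : ℕ}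
    {v : V} (hv : Reach G {q 0} n (q 1) v) :
    (n + 1 ≤ l → 3 ≤ G.degree v) ∧ (n + 2 ≤ l → G.degree v = 3) := by
  induction n using Nat.strong_induction_on generalizing v with
  | _ n ih =>
    obtain ⟨D, hD, p, hp, h0, rfl⟩ := hv.exists_geo
    have hr : ∀ m ≤ D, Reach G {q 0} m (q 1) (p m) := fun m hm => by
      have := hp.reach (Nat.zero_le m) hm
      rwa [h0, Nat.sub_zero] at this
    rcases hD.lt_or_eq with hlt | rfl
    · have := ih D hlt (hr D le_rfl)
      exact ⟨fun h => this.1 (by omega), fun h => this.2 (by omega)⟩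
    have hdeg : D + 1 ≤ l → ∀ m < D, G.degree (p m) = 3 := fun hl m hm =>
      (ih m hm (hr m hm.le)).2 (by omega)
    have hpx : ∀ m ≤ D, p m ≠ q 0 := fun m hm => hp.notMem m hm
    have h3 : D + 1 ≤ l → 3 ≤ G.degree (p D) := by
      intro hl
      have h2 := hcrit.two_le_degree hg (p D)
      by_contra hlt
      have hT : TwoPath G (D + 1) (consSeq (q 0) p) := by
        refine ⟨by omega, ?_, ?_, h.degree_zero.le, ?_, ?_⟩
        · rintro (_ | m) hm
          · change G.Adj (q 0) (p 0)
            rw [h0]; exact h.adj_zero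
          · exact hp.adj m (by omega)
        · rintro (_ | a) (_ | b) ha hb he
          · rfl
          · exact absurd he.symm (hpx b (by omega))
          · exact absurd he (hpx a (by omega))
          · rw [hp.inj (a := a) (b := b) (by omega) (by omega) he]
        · change G.degree (p D) ≤ 2; omega
        · rintro (_ | m) h1 h2
          · omega
          · exact (hdeg hl m (by omega)).le
      refine hT.not_isCritical hg ?_ hcrit
      rintro (_ | a) (_ | b) hab hb ⟨-, hm⟩
      · rfl
      · rfl
      · omega
      · exfalso
        rcases hm with ⟨h1, h2⟩ | ⟨f, hf, h1, h2⟩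
        · have h3 : b = a + 1 := hp.eq_succ_of_adj (by omega) (by omega) h1
          subst h3
          exact h2 ⟨a + 1, by omega, rfl⟩
        · refine hp.no_common hg (a := a) (b := b) (by omega) (by omega) ?_ ?_ h1 h2
          · rintro rfl; exact hf ⟨0, by omega, rfl⟩
          · rintro m hm rfl; exact hf ⟨m + 1, by omega, rfl⟩
    refine ⟨h3, fun hl => ?_⟩
    have := h3 (by omega)
    by_contra hne
    have := h.minimal D p hp h0 (hdeg (by omega)) (by omega)
    omega

/-- Two sails with the same axis do not come close to each other. -/
theorem not_reach {l' : ℕ} {q' : ℕ → V} (h : SailSeq G l q) (h' : SailSeq G l' q')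
    (hcrit : IsCritical G) (hg : 5 ≤ G.egirth) (hne : q 0 ≠ q' 0 ∨ q 1 ≠ q' 1) {n : ℕ}
    (hn : n + 3 ≤ l + l') (hr : Reach G {q 0, q' 0} n (q 1) (q' 1)) : False := by
  obtain ⟨D, hD, p, hp, h0, hD'⟩ := hr.exists_geo
  -- Since `n + 3 ≤ l + l'`, each `p m` is within `l - 2` steps of `q 1` or within `l' - 2` steps of
  -- `q' 1`.
  have hdeg : ∀ m ≤ D, G.degree (p m) = 3 := by
    intro m hm
    by_cases hml : m + 2 ≤ l
    · have h1 := (hp.reach (Nat.zero_le m) hm).mono (Y := {q 0}) (by simp)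
      rw [h0, Nat.sub_zero] at h1
      exact (h.degree_of_reach hcrit hg h1).2 hml
    · have h1 := ((hp.reach hm le_rfl).mono (Y := {q' 0}) (by simp)).symm
      rw [hD'] at h1
      exact (h'.degree_of_reach hcrit hg h1).2 (by omega)
  by_cases hx : q 0 = q' 0
  · rw [← hx, Set.pair_eq_singleton] at hp
    refine hp.not_isCritical_of_cycle hg ?_ h.degree_zero.le (by rw [h0]; exact h.adj_zero)
      (by rw [hD', hx]; exact h'.adj_zero) (fun m hm => (hdeg m hm).le) hcrit
    by_contra hlt
    obtain rfl : D = 0 := by omega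
    rw [h0] at hD'
    tauto
  have hpx : ∀ m ≤ D, p m ≠ q 0 := fun m hm he => hp.notMem m hm (by simp [he])
  have hpx' : ∀ m ≤ D, p m ≠ q' 0 := fun m hm he => hp.notMem m hm (by simp [he])
  -- For distinct tips, adding both to the geodesic gives a `TwoPath` of length `D + 2`, so only the
  -- exceptional case of length 4 survives.
  set Q := consSeq (q 0) (snocSeq D p (q' 0)) with hQ
  have Q0 : Q 0 = q 0 := rfl
  have Qp : ∀ m ≤ D, Q (m + 1) = p m := fun m hm => by simp [hQ, consSeq, snocSeq, hm]
  have QL : Q (D + 2) = q' 0 := by simp [hQ, consSeq, snocSeq]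
  have split : ∀ a, a ≤ D + 2 → a = 0 ∨ a = D + 2 ∨ ∃ m ≤ D, a = m + 1 := by
    intro a ha
    rcases a with _ | m
    · exact Or.inl rfl
    · by_cases hm : m ≤ D
      · exact Or.inr (Or.inr ⟨m, hm, rfl⟩)
      · exact Or.inr (Or.inl (by omega))
  have hT : TwoPath G (D + 2) Q := by
    refine ⟨by omega, ?_, ?_, by rw [Q0, h.degree_zero], by rw [QL, h'.degree_zero], ?_⟩
    · intro m hm
      rcases split m hm.le with rfl | rfl | ⟨k, hk, rfl⟩
      · rw [Qp 0 (by omega), Q0, h0]; exact h.adj_zero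
      · omega
      · rcases hk.lt_or_eq with hk | rfl
        · rw [Qp k hk.le, Qp (k + 1) hk]
          exact hp.adj k hk
        · rw [Qp k le_rfl, QL, hD']
          exact h'.adj_zero.symm
    · intro a b ha hb he
      rcases split a ha with rfl | rfl | ⟨k, hk, rfl⟩ <;>
        rcases split b hb with rfl | rfl | ⟨k', hk', rfl⟩
      · rfl
      · rw [Q0, QL] at he; exact absurd he hx
      · rw [Q0, Qp _ hk'] at he; exact absurd he.symm (hpx _ hk')
      · rw [Q0, QL] at he; exact absurd he.symm hx
      · rfl
      · rw [QL, Qp _ hk'] at he; exact absurd he.symm (hpx' _ hk')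
      · rw [Q0, Qp _ hk] at he; exact absurd he (hpx _ hk)
      · rw [QL, Qp _ hk] at he; exact absurd he (hpx' _ hk)
      · rw [Qp _ hk, Qp _ hk'] at he
        rw [hp.inj hk hk' he]
    · intro m h1 h2
      rcases split m h2.le with rfl | rfl | ⟨k, hk, rfl⟩
      · omega
      · omega
      · rw [Qp k hk]; exact (hdeg k hk).le
  obtain ⟨hL, hm1, hm2⟩ := hT.exceptional hg hcrit (by omega) (by
    rintro a b hab hb ⟨-, hm⟩
    rcases split a (by omega) with rfl | rfl | ⟨k, hk, rfl⟩
    · exact Or.inl rfl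
    · omega
    rcases split b hb with rfl | rfl | ⟨k', hk', rfl⟩
    · omega
    · exact Or.inr rfl
    exfalso
    rw [Qp _ hk, Qp _ hk'] at hm
    rcases hm with ⟨h1, h2⟩ | ⟨f, hf, h1, h2⟩
    · obtain rfl : k' = k + 1 := hp.eq_succ_of_adj (by omega) hk' h1
      exact h2 ⟨k + 1, by omega, by rw [Qp _ hk, Qp _ hk']⟩
    · refine hp.no_common hg (a := k) (b := k') (by omega) hk' ?_ ?_ h1 h2
      · rintro (rfl | rfl)
        · exact hf ⟨0, by omega, rfl⟩
        · exact hf ⟨D + 2, le_rfl, QL.symm⟩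
      · rintro m hm rfl; exact hf ⟨m + 1, by omega, (Qp m hm).symm⟩)
  obtain rfl : D = 2 := by omega
  rw [Q0, Qp 2 le_rfl, hD'] at hm1
  rw [Qp 0 (by omega), QL, h0] at hm2
  -- As `2 + 3 ≤ l + l'`, one sail has length at least 3. Its second vertex is a mate of the other
  -- tip, hence within two steps of a vertex of degree 2, against `degree_of_reach`.
  have key : ∀ {l : ℕ} {q : ℕ → V} {z : V}, SailSeq G l q → 3 ≤ l → z ≠ q 0 → G.degree z = 2 →
      q 0 ∈ pathVerts 4 Q → Mates G (pathVerts 4 Q) (pathEdges 4 Q) (q 1) z → False := by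
    intro l q z h hl hz hdz hq hm
    have hq1 : q 1 ∉ ({q 0} : Set V) := fun he => h.adj_zero.ne he.symm
    have hz' : z ∉ ({q 0} : Set V) := hz
    rcases hm.2 with ⟨h1, -⟩ | ⟨f, hf, h1, h2⟩
    · have := (h.degree_of_reach hcrit hg (.of_adj h1 hq1 hz')).1 (by omega)
      omega
    · have hf' : f ∉ ({q 0} : Set V) := by rintro rfl; exact hf hq
      have := (h.degree_of_reach hcrit hg ((Reach.of_adj h1.symm hq1 hf').trans
        (.of_adj h2 hf' hz'))).1 (by omega)
      omega
  by_cases hl : 3 ≤ l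
  · exact key h hl (Ne.symm hx) h'.degree_zero ⟨0, by omega, rfl⟩ hm2
  · exact key h' (by omega) hx h.degree_zero ⟨4, le_rfl, QL.symm⟩ hm1.symm

end SailSeq

end Sails

/-! ### Finding wheels -/

/-- `C` contains the vertex set of an induced subgraph that is an evil or almost evil wheel up to
the choice of types. -/
def ContainsWheel (G : SimpleGraph V) (C : Set V) : Prop :=
  ∃ S : Set V, S ⊆ C ∧ ∃ τ : S → Fin 3, IsEvilWheel (G.induce S) τ ∨
    IsAlmostEvilWheel (G.induce S) τ

/-- Rim positions congruent to 1 modulo 3 get type 2, and everything else, including the center,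
type 0. With anchors exactly three apart no rim vertex needs type 1, and the wheel is almost evil.
-/
theorem containsWheel_of_periodic {C : Set V} {m : ℕ} (hm : 2 ≤ m) {R : ℕ → V} {c : V}
    (hper : ∀ t, R (t + 3 * m) = R t) (hinj : ∀ s t, s < 3 * m → t < 3 * m → R s = R t → s = t)
    (hc : ∀ t, R t ≠ c) (hadj : ∀ t, G.Adj (R t) (R (t + 1)))
    (hind : ∀ s t, G.Adj (R s) (R t) → R t = R (s + 1) ∨ R s = R (t + 1))
    (hcen : ∀ t, G.Adj c (R t) ↔ 3 ∣ t) (hcC : c ∈ C) (hRC : ∀ t, R t ∈ C) :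
    ContainsWheel G C := by
  classical
  have hn0 : NeZero (3 * m) := ⟨by omega⟩
  have hmod : ∀ t, R (t % (3 * m)) = R t := fun t => Function.Periodic.map_mod_nat hper t
  have hR3 : ∀ s t, R s = R t → s % 3 = t % 3 := by
    intro s t h
    rw [← hmod s, ← hmod t] at h
    have := hinj _ _ (Nat.mod_lt _ (by omega)) (Nat.mod_lt _ (by omega)) h
    rw [← Nat.mod_mod_of_dvd s (Dvd.intro m rfl : 3 ∣ 3 * m), this,
      Nat.mod_mod_of_dvd t (Dvd.intro m rfl : 3 ∣ 3 * m)]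
  let S : Set V := {v | v = c ∨ ∃ t, v = R t}
  let r : ZMod (3 * m) → S := fun z => ⟨R z.val, Or.inr ⟨_, rfl⟩⟩
  have hr : ∀ t : ℕ, (r t : V) = R t := fun t => by
    change R ((t : ZMod (3 * m)).val) = R t
    rw [ZMod.val_natCast, hmod]
  have hr' : ∀ (s t : ℕ), r s = r t ↔ R s = R t := fun s t => by
    rw [← hr, ← hr, Subtype.ext_iff]
  have hrinj : Function.Injective r := by
    intro z w h
    have h' : R z.val = R w.val := congrArg Subtype.val h
    exact ZMod.val_injective _ (hinj _ _ (ZMod.val_lt z) (ZMod.val_lt w) h')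
  -- A representative of at least 2 keeps `t - 1` and `t - 2` free of truncation.
  have hcast : ∀ z : ZMod (3 * m), ∃ t : ℕ, 2 ≤ t ∧ z = t := fun z =>
    ⟨z.val + 3 * m, by omega, by simp⟩
  let A : Set (ZMod (3 * m)) := {z | 3 ∣ z.val}
  have hA : ∀ t : ℕ, (t : ZMod (3 * m)) ∈ A ↔ 3 ∣ t := fun t => by
    change 3 ∣ (t : ZMod (3 * m)).val ↔ _
    rw [ZMod.val_natCast, Nat.dvd_mod_iff ⟨m, rfl⟩]
  have h1 : ∀ t : ℕ, (t : ZMod (3 * m)) + 1 = ((t + 1 : ℕ) : ZMod (3 * m)) := by simp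
  have h2 : ∀ t : ℕ, (t : ZMod (3 * m)) + 2 = ((t + 2 : ℕ) : ZMod (3 * m)) := by simp
  have h3 : ∀ t : ℕ, (t : ZMod (3 * m)) + 3 = ((t + 3 : ℕ) : ZMod (3 * m)) := by simp
  let c' : S := ⟨c, Or.inl rfl⟩
  let τ : S → Fin 3 := fun v => if ∃ t, 3 ∣ t ∧ (v : V) = R (t + 1) then 2 else 0
  have hτ0 : ∀ t : ℕ, t % 3 ≠ 1 → τ (r t) = 0 := by
    intro t ht
    refine if_neg ?_
    rintro ⟨s, hs, h⟩
    rw [hr] at h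
    have := hR3 _ _ h
    omega
  have hτc : τ c' = 0 := if_neg fun ⟨s, _, h⟩ => hc _ h.symm
  refine ⟨S, ?_, τ, Or.inr ⟨3 * m, c', r, A, ⟨by omega, hrinj, ?_, ?_, ?_, ?_, ?_, ?_, ?_, ?_, ?_,
    ?_, Or.inl hτc⟩, ?_, hτc⟩⟩
  · rintro v (rfl | ⟨t, rfl⟩)
    exacts [hcC, hRC t]
  · intro z h
    exact hc _ (congrArg Subtype.val h)
  · rintro ⟨v, rfl | ⟨t, rfl⟩⟩
    · exact Or.inl rfl
    · exact Or.inr ⟨t, Subtype.ext (hr t).symm⟩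
  · intro z w
    obtain ⟨s, -, rfl⟩ := hcast z
    obtain ⟨t, -, rfl⟩ := hcast w
    rw [h1, h1, ← hrinj.eq_iff, ← hrinj.eq_iff (a := (s : ZMod (3 * m))), hr', hr',
      SimpleGraph.comap_adj]
    change G.Adj (r s : V) (r t : V) ↔ _
    rw [hr, hr]
    refine ⟨hind s t, ?_⟩
    rintro (h | h)
    · rw [h]; exact hadj s
    · rw [h]; exact (hadj t).symm
  · intro z
    obtain ⟨s, -, rfl⟩ := hcast z
    rw [hA, SimpleGraph.comap_adj]
    change G.Adj c (r s : V) ↔ _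
    rw [hr]
    exact hcen s
  · have : 1 < A.ncard := by
      rw [Set.one_lt_ncard (Set.toFinite _)]
      refine ⟨((0 : ℕ) : ZMod (3 * m)), (hA 0).2 (by omega), ((3 : ℕ) : ZMod (3 * m)),
        (hA 3).2 (dvd_refl 3), ?_⟩
      intro h
      have h' := (hr' 0 3).1 (congrArg r h)
      have := hinj _ _ (by omega) (by omega) h'
      omega
    exact this
  · intro z hz
    obtain ⟨s, -, rfl⟩ := hcast z
    rw [hA] at hz
    rw [h1, h2, hA, hA]
    omega
  · intro z hz
    obtain ⟨s, -, rfl⟩ := hcast z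
    rw [hA] at hz
    exact hτ0 s (by omega)
  · intro z hz
    obtain ⟨s, -, rfl⟩ := hcast z
    rw [hA] at hz
    rw [h1]
    exact if_pos ⟨s, hz, hr _⟩
  · intro z hz
    obtain ⟨s, -, rfl⟩ := hcast z
    rw [hA] at hz
    rw [h2]
    exact hτ0 _ (by omega)
  · intro z hz hz1 hz2
    obtain ⟨s, hs, rfl⟩ := hcast z
    have e1 : (s : ZMod (3 * m)) - 1 = ((s - 1 : ℕ) : ZMod (3 * m)) := by
      rw [Nat.cast_sub (by omega)]; simp
    have e2 : (s : ZMod (3 * m)) - 2 = ((s - 2 : ℕ) : ZMod (3 * m)) := by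
      rw [Nat.cast_sub (by omega)]; simp
    rw [e1, hA] at hz1
    rw [e2, hA] at hz2
    rw [hA] at hz
    omega
  · intro z hz
    obtain ⟨s, -, rfl⟩ := hcast z
    rw [hA] at hz
    rw [h3, hA]
    omega

/-! ### The wheel formed by a cyclic sequence of legs and flags -/

section Cycle

variable {C : Set V} {y : V} {m : ℕ} {a x o : ℕ → V}

/-- The chord closes the six-cycle `y, a i, x i, o i, o j, a (j + 1)`. The girth and the two
neighbours of `x i` make it induced, and `a (i + 1)` is adjacent to exactly its opposite vertices
`y` and `o i`, so it serves as the center. -/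
theorem containsWheel_of_chord
    (htri : ∀ a b c, G.Adj a b → G.Adj b c → G.Adj c a → False)
    (hC4 : ∀ a b c d, a ≠ c → b ≠ d → G.Adj a b → G.Adj b c → G.Adj c d → G.Adj d a → False)
    (hya : ∀ t, G.Adj y (a t)) (hax : ∀ t, G.Adj (a t) (x t)) (hxo : ∀ t, G.Adj (x t) (o t))
    (hoa : ∀ t, G.Adj (o t) (a (t + 1))) (hx : ∀ t u, G.Adj (x t) u → u = a t ∨ u = o t)
    (hoa' : ∀ s t, o s ≠ a t) (hox' : ∀ s t, o s ≠ x t) (hyx : ∀ t, y ≠ x t) (hyo : ∀ t, y ≠ o t)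
    (hyC : y ∈ C) (haC : ∀ t, a t ∈ C) (hxC : ∀ t, x t ∈ C) (hoC : ∀ t, o t ∈ C) {i j : ℕ}
    (hij : G.Adj (o i) (o j)) : ContainsWheel G C := by
  have nyx : ∀ t, ¬ G.Adj y (x t) := fun t h => htri _ _ _ (hya t) (hax t) h.symm
  have nyo : ∀ t, ¬ G.Adj y (o t) := fun t h => htri _ _ _ h (hoa t) (hya (t + 1)).symm
  have naa : ∀ s t, ¬ G.Adj (a s) (a t) := fun s t h => htri _ _ _ (hya s) h (hya t).symm
  have hne1 : a i ≠ a (j + 1) := fun h => by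
    have := hoa j
    rw [← h] at this
    exact hC4 _ _ _ _ (hoa' i i) (hox' j i).symm (hxo i).symm (hax i).symm this.symm hij.symm
  have hxa : ∀ s t, x s ≠ a t := fun s t h => nyx s (h ▸ hya t)
  have n13 : ¬ G.Adj (a i) (o i) := fun h => htri _ _ _ h (hxo i).symm (hax i).symm
  have n14 : ¬ G.Adj (a i) (o j) := fun h =>
    hC4 _ _ _ _ (hyo j) hne1 (hya i) h (hoa j) (hya _).symm
  have n24 : ¬ G.Adj (x i) (o j) := fun h => htri _ _ _ h hij.symm (hxo i).symm
  have n25 : ∀ t, a t ≠ a i → ¬ G.Adj (x i) (a t) := fun t hne h => by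
    rcases hx i _ h with h | h
    · exact hne h
    · exact hoa' _ _ h.symm
  have n35 : ¬ G.Adj (o i) (a (j + 1)) := fun h => htri _ _ _ h (hoa j).symm hij.symm
  have hci : a (i + 1) ≠ a i := fun h => n13 (h ▸ (hoa i).symm)
  have hcj : a (i + 1) ≠ a (j + 1) := fun h => n35 (h ▸ hoa i)
  have nco : ¬ G.Adj (a (i + 1)) (o j) := fun h => htri _ _ _ (hoa i) h hij.symm
  let v : Fin 6 → V := ![y, a i, x i, o i, o j, a (j + 1)]
  let R : ℕ → V := fun t => v (Fin.ofNat 6 t)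
  have hRv : ∀ t, R t = R (t % 6) := fun t => by
    simp only [R]; congr 1; ext; simp
  have hind : ∀ s t : Fin 6, s < t → G.Adj (v s) (v t) → t = s + 1 ∨ s = t + 1 := by
    intro s t hst h
    fin_cases s <;> fin_cases t <;> first
      | exact absurd hst (by decide)
      | exact Or.inl rfl
      | exact Or.inr rfl
      | (exfalso; revert h; first
          | exact nyx _ | exact nyo _ | exact naa _ _ | exact n13 | exact n14 | exact n24
          | exact n25 _ hne1.symm | exact n35)
  have hvinj : ∀ s t : Fin 6, s < t → v s ≠ v t := by
    intro s t hst
    fin_cases s <;> fin_cases t <;> first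
      | exact absurd hst (by decide)
      | exact (hya _).ne
      | exact hyx _
      | exact hyo _
      | exact (hax _).ne
      | exact (hoa' _ _).symm
      | exact hne1
      | exact (hox' _ _).symm
      | exact hxa _ _
      | exact hij.ne
      | exact hoa' _ _
  refine containsWheel_of_periodic (m := 2) (R := R) (c := a (i + 1)) le_rfl ?_ ?_ ?_ ?_ ?_ ?_
    (haC _) ?_
  · intro t
    rw [hRv, hRv t]; congr 1; omega
  · intro s t hs ht h
    have key : Fin.ofNat 6 s = Fin.ofNat 6 t := by
      rcases lt_trichotomy (Fin.ofNat 6 s) (Fin.ofNat 6 t) with h' | h' | h'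
      · exact absurd h (hvinj _ _ h')
      · exact h'
      · exact absurd h.symm (hvinj _ _ h')
    have := congrArg Fin.val key
    simp at this
    omega
  · intro t
    have : ∀ s : Fin 6, v s ≠ a (i + 1) := by
      intro s
      fin_cases s <;> first
        | exact (hya _).ne | exact hci.symm | exact hxa _ _ | exact hoa' _ _ | exact hcj.symm
    exact this _
  · intro t
    have : ∀ s : Fin 6, G.Adj (v s) (v (s + 1)) := by
      intro s
      fin_cases s <;> first
        | exact hya _ | exact hax _ | exact hxo _ | exact hij | exact hoa _ | exact (hya _).symm
    have h := this (Fin.ofNat 6 t)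
    have e : Fin.ofNat 6 t + 1 = Fin.ofNat 6 (t + 1) := by ext; simp [Fin.val_add]
    rwa [e] at h
  · intro s t h
    have e : ∀ t, Fin.ofNat 6 t + 1 = Fin.ofNat 6 (t + 1) := fun t => by ext; simp [Fin.val_add]
    have key : Fin.ofNat 6 t = Fin.ofNat 6 s + 1 ∨ Fin.ofNat 6 s = Fin.ofNat 6 t + 1 := by
      rcases lt_trichotomy (Fin.ofNat 6 s) (Fin.ofNat 6 t) with h' | h' | h'
      · exact hind _ _ h' h
      · exact absurd (congrArg v h') h.ne
      · exact (hind _ _ h' h.symm).symm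
    rw [e, e] at key
    exact key.imp (congrArg v) (congrArg v)
  · intro t
    have : ∀ s : Fin 6, G.Adj (a (i + 1)) (v s) ↔ 3 ∣ s.val := by
      intro s
      fin_cases s
      · exact iff_of_true (hya _).symm (by decide)
      · exact iff_of_false (naa _ _) (by decide)
      · exact iff_of_false (fun h => n25 _ hci h.symm) (by decide)
      · exact iff_of_true (hoa _).symm (by decide)
      · exact iff_of_false nco (by decide)
      · exact iff_of_false (naa _ _) (by decide)
    rw [this]
    simp
    omega
  · intro t
    have : ∀ s : Fin 6, v s ∈ C := by
      intro s
      fin_cases s <;> first | exact hyC | exact haC _ | exact hxC _ | exact hoC _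
    exact this _

/-- Without edges among the `o t`, the closed walk `a 0, x 0, o 0, a 1, …` is an induced cycle: any
other edge would create a triangle, a four-cycle through `y`, or a third neighbour of some `x t`.
The center is `y`. -/
theorem containsWheel_of_cycle (hm : 1 ≤ m)
    (htri : ∀ a b c, G.Adj a b → G.Adj b c → G.Adj c a → False)
    (hC4 : ∀ a b c d, a ≠ c → b ≠ d → G.Adj a b → G.Adj b c → G.Adj c d → G.Adj d a → False)
    (pa : ∀ t, a (t + m) = a t) (px : ∀ t, x (t + m) = x t) (po : ∀ t, o (t + m) = o t)
    (ha : ∀ s t, s < m → t < m → a s = a t → s = t)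
    (hya : ∀ t, G.Adj y (a t)) (hax : ∀ t, G.Adj (a t) (x t)) (hxo : ∀ t, G.Adj (x t) (o t))
    (hoa : ∀ t, G.Adj (o t) (a (t + 1))) (hx : ∀ t u, G.Adj (x t) u → u = a t ∨ u = o t)
    (hoa' : ∀ s t, o s ≠ a t) (hox' : ∀ s t, o s ≠ x t) (hyx : ∀ t, y ≠ x t) (hyo : ∀ t, y ≠ o t)
    (hyC : y ∈ C) (haC : ∀ t, a t ∈ C) (hxC : ∀ t, x t ∈ C) (hoC : ∀ t, o t ∈ C) :
    ContainsWheel G C := by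
  by_cases hoo : ∃ i j, G.Adj (o i) (o j)
  · obtain ⟨i, j, hij⟩ := hoo
    exact containsWheel_of_chord htri hC4 hya hax hxo hoa hx hoa' hox' hyx hyo hyC haC hxC hoC hij
  push Not at hoo
  have nyx : ∀ t, ¬ G.Adj y (x t) := fun t h => htri _ _ _ (hya t) (hax t) h.symm
  have nyo : ∀ t, ¬ G.Adj y (o t) := fun t h => htri _ _ _ h (hoa t) (hya (t + 1)).symm
  have naa : ∀ s t, ¬ G.Adj (a s) (a t) := fun s t h => htri _ _ _ (hya s) h (hya t).symm
  have hxa : ∀ s t, x s ≠ a t := fun s t h => nyx s (h ▸ hya t)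
  have hao : ∀ s t, G.Adj (a s) (o t) → a s = a (t + 1) := fun s t h => by
    by_contra hne
    exact hC4 _ _ _ _ (hyo t) hne (hya s) h (hoa t) (hya _).symm
  have hamod : ∀ s t, a s = a t → s % m = t % m := by
    intro s t h
    rw [← Function.Periodic.map_mod_nat (f := a) pa s,
      ← Function.Periodic.map_mod_nat (f := a) pa t] at h
    exact ha _ _ (Nat.mod_lt _ hm) (Nat.mod_lt _ hm) h
  have hxmod : ∀ s t, x s = x t → s % m = t % m := by
    intro s t h
    refine hamod s t (((hx t (a s) (h ▸ (hax s).symm)).resolve_right fun h' => hoa' _ _ h'.symm))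
  have homod : ∀ s t, o s = o t → s % m = t % m := by
    intro s t h
    have h1 := hamod _ _ (hao (s + 1) t (h ▸ (hoa s).symm))
    exact Nat.ModEq.add_right_cancel' 1 h1
  have modx : ∀ s t, s % m = t % m → x s = x t := fun s t h => by
    rw [← Function.Periodic.map_mod_nat (f := x) px s, h,
      Function.Periodic.map_mod_nat (f := x) px t]
  have modo : ∀ s t, s % m = t % m → o s = o t := fun s t h => by
    rw [← Function.Periodic.map_mod_nat (f := o) po s, h,
      Function.Periodic.map_mod_nat (f := o) po t]
  -- For `m = 1` the rim would be a triangle.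
  have hm2 : 2 ≤ m := by
    by_contra hlt
    obtain rfl : m = 1 := by omega
    have := hoa 0
    rw [pa 0] at this
    exact htri _ _ _ this (hax 0) (hxo 0)
  let R : ℕ → V := fun t => if t % 3 = 0 then a (t / 3) else if t % 3 = 1 then x (t / 3)
    else o (t / 3)
  have R0 : ∀ t, R (3 * t) = a t := fun t => by simp [R]
  have R1 : ∀ t, R (3 * t + 1) = x t := fun t => by
    simp only [R]
    rw [if_neg (by omega), if_pos (by omega)]; congr 1; omega
  have R2 : ∀ t, R (3 * t + 2) = o t := fun t => by
    simp only [R]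
    rw [if_neg (by omega), if_neg (by omega)]; congr 1; omega
  have R3 : ∀ t, R (3 * t + 2 + 1) = a (t + 1) := fun t => by rw [← R0]; congr 1
  have split : ∀ t, ∃ s, t = 3 * s ∨ t = 3 * s + 1 ∨ t = 3 * s + 2 := fun t =>
    ⟨t / 3, by omega⟩
  refine containsWheel_of_periodic hm2 (R := R) (c := y) ?_ ?_ ?_ ?_ ?_ ?_ hyC ?_
  · intro t
    obtain ⟨s, rfl | rfl | rfl⟩ := split t
    · rw [← Nat.mul_add, R0, R0, pa]
    · rw [show 3 * s + 1 + 3 * m = 3 * (s + m) + 1 by ring, R1, R1, px]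
    · rw [show 3 * s + 2 + 3 * m = 3 * (s + m) + 2 by ring, R2, R2, po]
  · intro s t hs ht h
    obtain ⟨s, rfl | rfl | rfl⟩ := split s <;> obtain ⟨t, rfl | rfl | rfl⟩ := split t <;>
      simp only [R0, R1, R2] at h
    · rw [ha s t (by omega) (by omega) h]
    · exact absurd h.symm (hxa _ _)
    · exact absurd h.symm (hoa' _ _)
    · exact absurd h (hxa _ _)
    · have := hxmod _ _ h
      rw [Nat.mod_eq_of_lt (by omega), Nat.mod_eq_of_lt (by omega)] at this
      rw [this]
    · exact absurd h.symm (hox' _ _)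
    · exact absurd h (hoa' _ _)
    · exact absurd h (hox' _ _)
    · have := homod _ _ h
      rw [Nat.mod_eq_of_lt (by omega), Nat.mod_eq_of_lt (by omega)] at this
      rw [this]
  · intro t
    obtain ⟨s, rfl | rfl | rfl⟩ := split t <;> simp only [R0, R1, R2]
    exacts [(hya _).ne.symm, (hyx _).symm, (hyo _).symm]
  · intro t
    obtain ⟨s, rfl | rfl | rfl⟩ := split t
    · rw [R0, R1]; exact hax s
    · rw [R1, R2]; exact hxo s
    · rw [R2, R3]; exact hoa s
  · have hxaeq : ∀ s t, G.Adj (x s) (a t) → a t = a s := fun s t h =>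
      (hx s _ h).resolve_right fun h' => hoa' _ _ h'.symm
    have hxoeq : ∀ s t, G.Adj (x s) (o t) → o t = o s := fun s t h =>
      (hx s _ h).resolve_left (hoa' _ _)
    intro s t h
    obtain ⟨s, rfl | rfl | rfl⟩ := split s <;> obtain ⟨t, rfl | rfl | rfl⟩ := split t <;>
      simp only [R0, R1, R2, R3] at h ⊢
    · exact absurd h (naa _ _)
    · exact Or.inl (modx _ _ (hamod _ _ (hxaeq _ _ h.symm)).symm)
    · exact Or.inr (hao _ _ h)
    · exact Or.inr (modx _ _ (hamod _ _ (hxaeq _ _ h)).symm)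
    · rcases hx _ _ h with h | h
      · exact absurd h (hxa _ _)
      · exact absurd h.symm (hox' _ _)
    · exact Or.inl (hxoeq _ _ h)
    · exact Or.inl (hao _ _ h.symm)
    · exact Or.inr (hxoeq _ _ h.symm)
    · exact absurd h (hoo _ _)
  · intro t
    obtain ⟨s, rfl | rfl | rfl⟩ := split t <;> simp only [R0, R1, R2]
    · exact iff_of_true (hya s) (by omega)
    · exact iff_of_false (nyx s) (by omega)
    · exact iff_of_false (nyo s) (by omega)
  · intro t
    obtain ⟨s, rfl | rfl | rfl⟩ := split t <;> simp only [R0, R1, R2]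
    exacts [haC s, hxC s, hoC s]

end Cycle

/-! ### Cycles of right-unique relations -/

/-- Right-uniqueness makes `R` a partial function `f`, and the closed walk makes `i` a periodic
point of `f`. Taking the minimal period excludes repetitions. -/
theorem exists_periodic_of_transGen {ι : Type*} {R : ι → ι → Prop}
    (huniq : ∀ i j j', R i j → R i j' → j = j') {i : ι} (hi : Relation.TransGen R i i) :
    ∃ m : ℕ, 1 ≤ m ∧ ∃ c : ℕ → ι, (∀ t, c (t + m) = c t) ∧ (∀ t, R (c t) (c (t + 1))) ∧
      ∀ s t, s < m → t < m → c s = c t → s = t := by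
  classical
  let f : ι → ι := fun i => if h : ∃ j, R i j then h.choose else i
  have hf : ∀ i j, R i j → f i = j := fun i j h => by
    have h' : ∃ j, R i j := ⟨j, h⟩
    simp only [f, dif_pos h']
    exact huniq _ _ _ h'.choose_spec h
  have hreach : ∀ j, Relation.TransGen R i j → ∃ n, 0 < n ∧ f^[n] i = j := by
    intro j hj
    induction hj with
    | single h => exact ⟨1, one_pos, hf _ _ h⟩
    | tail _ h ih =>
      obtain ⟨n, -, hn⟩ := ih
      exact ⟨n + 1, by omega, by rw [Function.iterate_succ_apply', hn, hf _ _ h]⟩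
  obtain ⟨n, hn, hni⟩ := hreach i hi
  have hstep : ∀ j, Relation.TransGen R j i → R j (f j) ∧ Relation.TransGen R (f j) i := by
    intro j hj
    obtain ⟨k, hjk, hk⟩ := Relation.TransGen.head'_iff.1 hj
    rw [hf _ _ hjk]
    refine ⟨hjk, ?_⟩
    rcases Relation.reflTransGen_iff_eq_or_transGen.1 hk with h | h
    · rwa [← h]
    · exact h
  have hall : ∀ t, Relation.TransGen R (f^[t] i) i := by
    intro t
    induction t with
    | zero => exact hi
    | succ t ih =>
      rw [Function.iterate_succ_apply']
      exact (hstep _ ih).2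
  refine ⟨Function.minimalPeriod f i, ?_, fun t => f^[t] i, ?_, ?_, ?_⟩
  · exact Function.IsPeriodicPt.minimalPeriod_pos hn hni
  · intro t
    exact Function.iterate_add_minimalPeriod_eq
  · intro t
    change R (f^[t] i) (f^[t + 1] i)
    rw [Function.iterate_succ_apply']
    exact (hstep _ (hall t)).1
  · intro s t hs ht h
    exact Function.iterate_injOn_Iio_minimalPeriod hs ht h

/-! ### Families of sails with a common axis -/

section Family

variable [Fintype V] [DecidableRel G.Adj]

namespace SailSeq

variable {l : ℕ} {q : ℕ → V}

theorem inj (h : SailSeq G l q) {a b : ℕ} (ha : a ≤ l) (hb : b ≤ l) (he : q a = q b) : a = b := by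
  have hl := h.pos
  rcases a with _ | a <;> rcases b with _ | b
  · rfl
  · exact absurd he.symm (h.geo.notMem b (by omega))
  · exact absurd he (h.geo.notMem a (by omega))
  · rw [h.geo.inj (a := a) (b := b) (by omega) (by omega) he]

theorem adj (h : SailSeq G l q) {m : ℕ} (hm : m < l) : G.Adj (q m) (q (m + 1)) := by
  rcases m with _ | m
  · exact h.adj_zero
  · exact h.geo.adj m (by omega)

theorem three_le_degree (h : SailSeq G l q) {m : ℕ} (h0 : 0 < m) (hm : m ≤ l) :
    3 ≤ G.degree (q m) := by
  rcases hm.lt_or_eq with hm | rfl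
  · exact (h.degree_mid m h0 hm).ge
  · have := h.degree_last; omega

theorem notMem_of_degree (h : SailSeq G l q) {X : Set V} (hX : ∀ x ∈ X, G.degree x = 2) {m : ℕ}
    (h0 : 0 < m) (hm : m ≤ l) : q m ∉ X := fun hmem => by
  have := h.three_le_degree h0 hm
  have := hX _ hmem
  omega

theorem reach (h : SailSeq G l q) {X : Set V} (hX : ∀ x ∈ X, G.degree x = 2) {a b : ℕ}
    (ha : 0 < a) (hab : a ≤ b) (hb : b ≤ l) : Reach G X (b - a) (q a) (q b) :=
  .of_seq hab (fun m _ hm => h.adj (by omega))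
    (fun _ _ _ => h.notMem_of_degree hX (by omega) (by omega))

end SailSeq

/-- At least `d(y) - 1` sails with distinct tips and common axis `y`. -/
structure SailFamily (G : SimpleGraph V) [DecidableRel G.Adj] (y : V) (k : ℕ) (l : Fin k → ℕ)
    (q : Fin k → ℕ → V) : Prop where
  sail : ∀ i, SailSeq G (l i) (q i)
  last : ∀ i, q i (l i) = y
  tips : ∀ i j, i ≠ j → q i 0 ≠ q j 0 ∨ q i 1 ≠ q j 1
  degree_le : G.degree y ≤ k + 1
  pos : 0 < k

/-- A leg is low if it is longest among the legs with its tip, unless it is a single edge. -/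
def LowLeg {k : ℕ} (l : Fin k → ℕ) (q : Fin k → ℕ → V) (i : Fin k) : Prop :=
  2 ≤ l i ∧ ∀ j, j ≠ i → q j 0 = q i 0 → l j < l i ∨ (l j = l i ∧ j < i)

namespace SailFamily

variable {y : V} {k : ℕ} {l : Fin k → ℕ} {q : Fin k → ℕ → V}

theorem ne_axis (h : SailFamily G y k l q) {i : Fin k} {m : ℕ} (hm : m < l i) : q i m ≠ y := by
  intro he
  rw [← h.last i] at he
  have := (h.sail i).inj hm.le le_rfl he
  omega

theorem adj_axis (h : SailFamily G y k l q) (i : Fin k) : G.Adj y (q i (l i - 1)) := by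
  have hl := (h.sail i).pos
  have := (h.sail i).adj (m := l i - 1) (by omega)
  rw [show l i - 1 + 1 = l i by omega, h.last] at this
  exact this.symm

/-- Two legs meeting at inner vertices would give a walk between their second vertices that is too
short for `SailSeq.not_reach`. A tip is never an inner vertex, by degree. -/
theorem inj (h : SailFamily G y k l q) (hcrit : IsCritical G) (hg : 5 ≤ G.egirth) {i j : Fin k}
    {m n : ℕ} (hm : m < l i) (hn : n < l j) (he : q i m = q j n) :
    (i = j ∧ m = n) ∨ (m = 0 ∧ n = 0) := by
  by_cases hij : i = j
  · subst hij
    exact Or.inl ⟨rfl, (h.sail i).inj hm.le hn.le he⟩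
  right
  have key : ∀ {i j : Fin k} {m n : ℕ}, m < l i → n < l j → q i m = q j n → m = 0 → n = 0 := by
    rintro i j m n hm hn he rfl
    by_contra h0
    have h1 := (h.sail j).degree_mid n (by omega) hn
    rw [← he, (h.sail i).degree_zero] at h1
    omega
  by_cases hm0 : m = 0
  · exact ⟨hm0, key hm hn he hm0⟩
  by_cases hn0 : n = 0
  · exact ⟨key hn hm he.symm hn0, hn0⟩
  exfalso
  have hX : ∀ x ∈ ({q i 0, q j 0} : Set V), G.degree x = 2 := by
    rintro x (rfl | rfl)
    exacts [(h.sail i).degree_zero, (h.sail j).degree_zero]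
  have h1 := (h.sail i).reach hX one_pos (b := m) (by omega) hm.le
  have h2 := (h.sail j).reach hX one_pos (b := n) (by omega) hn.le
  rw [he] at h1
  exact (h.sail i).not_reach (h.sail j) hcrit hg (h.tips i j hij) (by omega) (h1.trans h2.symm)

theorem snd_ne (h : SailFamily G y k l q) {i j : Fin k} (hij : i ≠ j) (h0 : q i 0 = q j 0) :
    q i 1 ≠ q j 1 := (h.tips i j hij).resolve_left (not_not_intro h0)

theorem eq_snd_of_shared (h : SailFamily G y k l q) {i j : Fin k} (hij : i ≠ j)
    (h0 : q i 0 = q j 0) {u : V} (hu : G.Adj (q i 0) u) : u = q i 1 ∨ u = q j 1 := by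
  by_contra! hne
  exact hne.2 (eq_of_degree_two (h.sail i).degree_zero.le (h.sail i).adj_zero hu
    (by rw [h0]; exact (h.sail j).adj_zero) hne.1 (h.snd_ne hij h0).symm)

theorem shared_unique (h : SailFamily G y k l q) {i j j' : Fin k} (hij : j ≠ i) (hij' : j' ≠ i)
    (h0 : q j 0 = q i 0) (h0' : q j' 0 = q i 0) : j = j' := by
  by_contra hne
  have h1 : G.Adj (q i 0) (q j' 1) := by rw [← h0']; exact (h.sail j').adj_zero
  rcases h.eq_snd_of_shared hij.symm h0.symm h1 with h2 | h2
  · exact h.snd_ne hij' h0' h2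
  · exact h.snd_ne (Ne.symm hne) (h0'.trans h0.symm) h2

/-- Lengths 1 and 1 would give equal tips of sails, 1 and 2 a triangle, 2 and 2 a four-cycle. -/
theorem three_le_of_shared (h : SailFamily G y k l q) (hg : 5 ≤ G.egirth) {i j : Fin k}
    (hij : i ≠ j) (h0 : q i 0 = q j 0) : 3 ≤ l i ∨ 3 ≤ l j := by
  have htri : ∀ {i j : Fin k}, q i 0 = q j 0 → l i = 1 → l j = 2 → False := by
    intro i j h0 hi hj
    have h1 := h.adj_axis i
    have h2 := h.adj_axis j
    rw [hi, Nat.sub_self, h0] at h1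
    rw [hj] at h2
    exact not_triangle hg _ _ _ h1 (h.sail j).adj_zero h2.symm
  have hi := (h.sail i).pos
  have hj := (h.sail j).pos
  by_contra! hlt
  have hi' : l i = 1 ∨ l i = 2 := by omega
  have hj' : l j = 1 ∨ l j = 2 := by omega
  rcases hi' with hi' | hi' <;> rcases hj' with hj' | hj'
  · have h1 := h.last i
    have h2 := h.last j
    rw [hi'] at h1
    rw [hj'] at h2
    exact h.snd_ne hij h0 (h1.trans h2.symm)
  · exact htri h0 hi' hj'
  · exact htri h0.symm hj' hi'
  · have h1 := h.adj_axis i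
    have h2 := h.adj_axis j
    rw [hi'] at h1
    rw [hj'] at h2
    refine not_fourCycle hg _ _ _ _ (h.ne_axis (i := i) (m := 0) (by omega)) (h.snd_ne hij h0)
      (h.sail i).adj_zero h1.symm h2 ?_
    rw [h0]; exact (h.sail j).adj_zero.symm

theorem lowLeg_iff (h : SailFamily G y k l q) (hg : 5 ≤ G.egirth) {i j : Fin k}
    (hij : i ≠ j) (h0 : q i 0 = q j 0) :
    LowLeg l q i ↔ l j < l i ∨ (l j = l i ∧ j < i) := by
  have h3 := h.three_le_of_shared hg hij h0
  refine ⟨fun hi => hi.2 j hij.symm h0.symm, fun hlt => ⟨by omega, fun m hm hm0 => ?_⟩⟩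
  rwa [h.shared_unique hm hij.symm hm0 h0.symm]

theorem spider (h : SailFamily G y k l q) (hcrit : IsCritical G) (hg : 5 ≤ G.egirth) :
    Spider G y l q (LowLeg l q) := by
  classical
  refine ⟨fun i => (h.sail i).pos, h.last, fun i m hm => (h.sail i).adj hm,
    fun i m hm => h.ne_axis hm, fun i j m n hm hn he => h.inj hcrit hg hm hn he, ?_, ?_,
    fun i hi => hi.1, ?_, ?_, ?_⟩
  · rintro s (rfl | ⟨i, m, hm, rfl⟩) u u' hu hnu hu' hnu'
    · have hpen : Function.Injective fun i => q i (l i - 1) := by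
        intro i j he
        have hi := (h.sail i).pos
        have hj := (h.sail j).pos
        by_contra hij
        rcases h.inj hcrit hg (by omega) (by omega) he with ⟨h1, -⟩ | ⟨h1, h2⟩
        · exact hij h1
        · have e1 := h.last i
          have e2 := h.last j
          rw [show l i = 1 by omega] at e1
          rw [show l j = 1 by omega] at e2
          rcases h.tips i j hij with h3 | h3
          · apply h3
            simpa [h1, h2] using he
          · exact h3 (e1.trans e2.symm)
      have hmem : ∀ z, s(s, z) ∉ spiderEdges l q →
          z ∉ (Finset.univ.image fun i => q i (l i - 1)) := by
        intro z hz hmem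
        obtain ⟨i, -, rfl⟩ := Finset.mem_image.1 hmem
        have hi := (h.sail i).pos
        refine hz ⟨i, l i - 1, by omega, ?_⟩
        rw [show l i - 1 + 1 = l i by omega, h.last, Sym2.eq_swap]
      refine eq_of_degree_le (Finset.univ.image fun i => q i (l i - 1)) ?_ ?_ hu hu'
        (hmem u hnu) (hmem u' hnu')
      · intro z hz
        obtain ⟨i, -, rfl⟩ := Finset.mem_image.1 hz
        exact h.adj_axis i
      · rw [Finset.card_image_of_injective _ hpen]
        simpa using h.degree_le
    · have up : ∀ z, s(q i m, z) ∉ spiderEdges l q → z ≠ q i (m + 1) := by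
        rintro _ hz rfl; exact hz ⟨i, m, hm, rfl⟩
      rcases m with _ | m
      · exact eq_of_degree_two (h.sail i).degree_zero.le (h.sail i).adj_zero hu hu'
          (up u hnu) (up u' hnu')
      · have dn : ∀ z, s(q i (m + 1), z) ∉ spiderEdges l q → z ≠ q i m := by
          rintro _ hz rfl; exact hz ⟨i, m, by omega, Sym2.eq_swap⟩
        refine eq_of_degree_three ((h.sail i).degree_mid _ (by omega) hm).le ?_
          ((h.sail i).adj hm) ((h.sail i).adj (m := m) (by omega)).symm hu hu' (up u hnu)
          (up u' hnu') (dn u hnu) (dn u' hnu')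
        intro he
        have := (h.sail i).inj (by omega) (by omega) he
        omega
  · intro i j hij h0 u hu
    rcases h.eq_snd_of_shared hij h0 hu with rfl | rfl
    · exact ⟨i, 0, (h.sail i).pos, rfl⟩
    · exact ⟨j, 0, (h.sail j).pos, by rw [h0]⟩
  · intro i j hij h0
    rw [h.lowLeg_iff hg hij h0, h.lowLeg_iff hg hij.symm h0.symm]
    omega
  · intro i j hij h0 hi
    have h3 := h.three_le_of_shared hg hij h0
    rw [h.lowLeg_iff hg hij h0] at hi
    omega
  · intro i hi h2
    by_contra! hne
    exact hi ⟨h2, fun j hj h0 => absurd h0 (hne j hj)⟩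

theorem exists_of_mem (h : SailFamily G y k l q) {s : V} (hs : s ∈ spiderVerts y l q) :
    ∃ i m, m ≤ l i ∧ s = q i m := by
  rcases hs with rfl | ⟨i, m, hm, rfl⟩
  · exact ⟨⟨0, h.pos⟩, _, le_rfl, (h.last _).symm⟩
  · exact ⟨i, m, hm.le, rfl⟩

theorem mem_verts (h : SailFamily G y k l q) {i : Fin k} {m : ℕ} (hm : m ≤ l i) :
    q i m ∈ spiderVerts y l q := by
  rcases hm.lt_or_eq with hm | rfl
  · exact Or.inr ⟨i, m, hm, rfl⟩
  · exact Or.inl (h.last i)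

theorem not_mates_same (h : SailFamily G y k l q) (hg : 5 ≤ G.egirth) {i : Fin k} {a b : ℕ}
    (ha : 0 < a) (hb : 0 < b) (hal : a ≤ l i) (hbl : b ≤ l i) :
    ¬ Mates G (spiderVerts y l q) (spiderEdges l q) (q i a) (q i b) := by
  have key : ∀ {a b : ℕ}, 0 < a → a < b → b ≤ l i →
      ¬ Mates G (spiderVerts y l q) (spiderEdges l q) (q i a) (q i b) := by
    rintro a b ha hab hbl ⟨-, hm⟩
    obtain ⟨a, rfl⟩ : ∃ a', a = a' + 1 := ⟨a - 1, by omega⟩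
    obtain ⟨b, rfl⟩ : ∃ b', b = b' + 1 := ⟨b - 1, by omega⟩
    rcases hm with ⟨h1, h2⟩ | ⟨f, hf, h1, h2⟩
    · obtain rfl : b = a + 1 := (h.sail i).geo.eq_succ_of_adj (by omega) (by omega) h1
      exact h2 ⟨i, a + 1, by omega, rfl⟩
    · refine (h.sail i).geo.no_common hg (a := a) (b := b) (by omega) (by omega) ?_ ?_ h1 h2
      · rintro rfl; exact hf (h.mem_verts (Nat.zero_le _))
      · rintro m hm rfl; exact hf (h.mem_verts (by omega))
  intro hm
  rcases lt_trichotomy a b with hlt | rfl | hlt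
  · exact key ha hlt hbl hm
  · exact hm.1 rfl
  · exact key hb hlt hal hm.symm

/-- Mates on two different legs, neither of them a tip or the axis, would join the second vertices
by a walk too short for `SailSeq.not_reach`. The one case that it misses, a common outside neighbour
of two neighbours of `y`, is a four-cycle. -/
theorem not_mates_of_pos (h : SailFamily G y k l q) (hcrit : IsCritical G) (hg : 5 ≤ G.egirth)
    {i j : Fin k} {a b : ℕ} (ha : 0 < a) (hb : 0 < b) (hal : a ≤ l i) (hbl : b ≤ l j) :
    ¬ Mates G (spiderVerts y l q) (spiderEdges l q) (q i a) (q j b) := by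
  intro hm
  rcases hal.lt_or_eq with hal' | rfl
  swap
  · rw [h.last i] at hm
    exact h.not_mates_same hg (h.sail j).pos hb le_rfl hbl (by rwa [h.last j])
  rcases hbl.lt_or_eq with hbl' | rfl
  swap
  · rw [h.last j] at hm
    exact h.not_mates_same hg ha (h.sail i).pos hal le_rfl (by rwa [h.last i])
  by_cases hij : i = j
  · subst hij
    exact h.not_mates_same hg ha hb hal hbl hm
  have hX : ∀ x ∈ ({q i 0, q j 0} : Set V), G.degree x = 2 := by
    rintro x (rfl | rfl)
    exacts [(h.sail i).degree_zero, (h.sail j).degree_zero]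
  have r1 := (h.sail i).reach hX one_pos ha hal
  have r2 := (h.sail j).reach hX one_pos hb hbl
  have n1 := (h.sail i).notMem_of_degree hX ha hal
  have n2 := (h.sail j).notMem_of_degree hX hb hbl
  obtain ⟨hne, ⟨h1, h2⟩ | ⟨f, hf, h1, h2⟩⟩ := hm
  · exact (h.sail i).not_reach (h.sail j) hcrit hg (h.tips i j hij) (by omega)
      ((r1.trans (.of_adj h1 n1 n2)).trans r2.symm)
  · have nf : f ∉ ({q i 0, q j 0} : Set V) := by
      rintro (rfl | rfl) <;> exact hf (h.mem_verts (Nat.zero_le _))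
    by_cases hlast : a + 1 = l i ∧ b + 1 = l j
    · have e1 := h.adj_axis i
      have e2 := h.adj_axis j
      rw [← hlast.1, Nat.add_sub_cancel] at e1
      rw [← hlast.2, Nat.add_sub_cancel] at e2
      refine not_fourCycle hg f _ y _ ?_ hne h1 e1.symm e2 h2.symm
      rintro rfl
      exact hf (Or.inl rfl)
    · exact (h.sail i).not_reach (h.sail j) hcrit hg (h.tips i j hij) (by omega)
        ((r1.trans ((Reach.of_adj h1.symm n1 nf).trans (.of_adj h2 nf n2))).trans r2.symm)

/-- The tip `q i 0` has degree 2, so by `degree_of_reach` it is not within `l j - 1` steps of `q j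
1` in `G - q j 0`. This rules out an edge, and allows a flag only next to the axis. -/
theorem flag_of_mates (h : SailFamily G y k l q) (hcrit : IsCritical G) (hg : 5 ≤ G.egirth)
    {i j : Fin k} {b : ℕ} (hb : 0 < b) (hbl : b < l j) (hij : q i 0 ≠ q j 0)
    (hm : Mates G (spiderVerts y l q) (spiderEdges l q) (q i 0) (q j b)) :
    b + 1 = l j ∧ ∃ f ∉ spiderVerts y l q, G.Adj f (q i 0) ∧ G.Adj f (q j b) := by
  have hX : ∀ x ∈ ({q j 0} : Set V), G.degree x = 2 := by
    rintro x rfl; exact (h.sail j).degree_zero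
  have r := (h.sail j).reach hX one_pos hb hbl.le
  have n := (h.sail j).notMem_of_degree hX hb hbl.le
  have hdeg := (h.sail i).degree_zero
  obtain ⟨-, ⟨h1, h2⟩ | ⟨f, hf, h1, h2⟩⟩ := hm
  · have := ((h.sail j).degree_of_reach hcrit hg (r.trans (.of_adj h1.symm n hij))).1 (by omega)
    omega
  · refine ⟨?_, f, hf, h1, h2⟩
    have nf : f ∉ ({q j 0} : Set V) := by
      rintro rfl; exact hf (h.mem_verts (Nat.zero_le _))
    by_contra hlt
    have := ((h.sail j).degree_of_reach hcrit hg
      (r.trans ((Reach.of_adj h2.symm n nf).trans (.of_adj h1 nf hij)))).1 (by omega)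
    omega

theorem low_or_length_eq_one (h : SailFamily G y k l q) (hcrit : IsCritical G) (hg : 5 ≤ G.egirth)
    {i : Fin k} {t : V}
    (hm : Mates G (spiderVerts y l q) (spiderEdges l q) (q i 0) t) :
    LowLeg l q i ∨ l i = 1 := by
  have hs := h.spider hcrit hg
  by_contra! hne
  have hi := (h.sail i).pos
  obtain ⟨j, hj, h0⟩ := hs.not_low i hne.1 (by omega)
  exact hs.free_of_mates hm j hj h0

/-- A tip with a mate is unshared, so it is the tip of a low leg or of a single-edge leg. In the
latter case the tip is adjacent to `y`, and a mate that is not itself a low tip would close a cycle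
of length at most 4. -/
theorem low_of_mates (h : SailFamily G y k l q) (hcrit : IsCritical G) (hg : 5 ≤ G.egirth)
    {s : V} (hs : s ∈ spiderVerts y l q) {t : V} (ht : t ∈ spiderVerts y l q)
    (hm : Mates G (spiderVerts y l q) (spiderEdges l q) s t) :
    ∃ i, LowLeg l q i ∧ (s = q i 0 ∨ t = q i 0) := by
  have hsp := h.spider hcrit hg
  have key : ∀ {i j : Fin k} {b : ℕ}, b ≤ l j →
      Mates G (spiderVerts y l q) (spiderEdges l q) (q i 0) (q j b) →
      ∃ m, LowLeg l q m ∧ (q i 0 = q m 0 ∨ q j b = q m 0) := by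
    intro i j b hb hm
    rcases h.low_or_length_eq_one hcrit hg hm with hi | hi
    · exact ⟨i, hi, Or.inl rfl⟩
    have e1 := h.adj_axis i
    rw [hi, Nat.sub_self] at e1
    have hq1 : q i 1 = y := by rw [← hi, h.last]
    have hty : q j b ≠ y := by
      intro he
      obtain ⟨-, ⟨-, h2⟩ | ⟨f, -, h1, h2⟩⟩ := hm
      · exact h2 ⟨i, 0, by omega, by rw [he, hq1]⟩
      · rw [he] at h2
        exact not_triangle hg _ _ _ h1 e1.symm h2.symm
    have hbl : b < l j := by
      rcases hb.lt_or_eq with hb | rfl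
      · exact hb
      · exact absurd (h.last j) hty
    rcases Nat.eq_zero_or_pos b with rfl | hb0
    · rcases h.low_or_length_eq_one hcrit hg hm.symm with hj | hj
      · exact ⟨j, hj, Or.inr rfl⟩
      · exfalso
        have e2 := h.adj_axis j
        rw [hj, Nat.sub_self] at e2
        obtain ⟨hne, ⟨h1, -⟩ | ⟨f, hf, h1, h2⟩⟩ := hm
        · exact not_triangle hg _ _ _ e1 h1 e2.symm
        · refine not_fourCycle hg f _ y _ ?_ hne h1 e1.symm e2 h2.symm
          rintro rfl; exact hf (Or.inl rfl)
    · exfalso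
      have hij : q i 0 ≠ q j 0 := by
        intro he
        by_cases hij : i = j
        · subst hij; omega
        · exact hsp.free_of_mates hm j (Ne.symm hij) he.symm
      obtain ⟨h1, f, hf, h2, h3⟩ := h.flag_of_mates hcrit hg hb0 hbl hij hm
      have e2 := h.adj_axis j
      rw [← h1, Nat.add_sub_cancel] at e2
      refine not_fourCycle hg f _ y _ ?_ hm.1 h2 e1.symm e2 h3.symm
      rintro rfl; exact hf (Or.inl rfl)
  obtain ⟨i, a, ha, rfl⟩ := h.exists_of_mem hs
  obtain ⟨j, b, hb, rfl⟩ := h.exists_of_mem ht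
  rcases Nat.eq_zero_or_pos a with rfl | ha0
  · exact key hb hm
  rcases Nat.eq_zero_or_pos b with rfl | hb0
  · obtain ⟨m, h1, h2⟩ := key ha hm.symm
    exact ⟨m, h1, h2.symm⟩
  · exact absurd hm (h.not_mates_of_pos hcrit hg ha0 hb0 ha hb)

/-- Arcs of the spider come from flags next to the axis or from shared tips. -/
theorem arc_cases (h : SailFamily G y k l q) (hcrit : IsCritical G) (hg : 5 ≤ G.egirth)
    {i j : Fin k} (hij : Arc G y l q (LowLeg l q) i j) :
    (l i = 2 ∧ LowLeg l q i ∧ ∃ f ∉ spiderVerts y l q, G.Adj (q i 0) f ∧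
      G.Adj f (q j (l j - 1))) ∨ (l i = 1 ∧ j ≠ i ∧ q j 0 = q i 0) := by
  have hsp := h.spider hcrit hg
  obtain ⟨hne, ⟨hlow, hl, n, hn, hnl, hm⟩ | ⟨h0, hl⟩⟩ := hij
  swap
  · exact Or.inr ⟨hl, hne.symm, h0.symm⟩
  refine Or.inl ⟨hl, hlow, ?_⟩
  have h0 : q i 0 ≠ q j 0 := (hsp.free_of_mates hm j hne.symm).symm
  rcases Nat.eq_zero_or_pos n with rfl | hn0
  · have hj : l j = 1 := (h.low_or_length_eq_one hcrit hg hm.symm).resolve_left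
      fun hj => hnl ⟨hj, rfl⟩
    obtain ⟨-, ⟨h1, -⟩ | ⟨f, hf, h1, h2⟩⟩ := hm
    · exfalso
      have e1 := h.adj_axis i
      have e2 := h.adj_axis j
      rw [hl] at e1
      rw [hj, Nat.sub_self] at e2
      refine not_fourCycle hg _ _ _ _ (h.ne_axis (i := i) (m := 0) (by omega)) ?_ h1 e2.symm e1
        (h.sail i).adj_zero.symm
      intro he
      have := h.inj hcrit hg (by omega) (by omega) he
      omega
    · exact ⟨f, hf, h1.symm, by rwa [hj]⟩
  · obtain ⟨h1, f, hf, h2, h3⟩ := h.flag_of_mates hcrit hg hn0 hn h0 hm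
    exact ⟨f, hf, h2.symm, by rwa [← h1, Nat.add_sub_cancel]⟩

theorem pen_inj (h : SailFamily G y k l q) (hcrit : IsCritical G) (hg : 5 ≤ G.egirth)
    {i j : Fin k} (he : q i (l i - 1) = q j (l j - 1)) : i = j := by
  have hsp := h.spider hcrit hg
  have hi := (h.sail i).pos
  have hj := (h.sail j).pos
  refine (hsp.edge_inj (m := l i - 1) (n := l j - 1) (by omega) (by omega) ?_).1
  rw [he, show l i - 1 + 1 = l i by omega, show l j - 1 + 1 = l j by omega, h.last, h.last]

theorem containsWheel (h : SailFamily G y k l q) (hcrit : IsCritical G) (hg : 5 ≤ G.egirth) :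
    ContainsWheel G (closureVerts G (spiderVerts y l q)) := by
  have hsp := h.spider hcrit hg
  obtain ⟨i, hi⟩ := hsp.exists_transGen_arc hcrit (not_triangle hg) (not_fourCycle hg)
    (fun s hs t ht hm => h.low_of_mates hcrit hg hs ht hm)
  have flag_unique : ∀ {i : Fin k} {f u : V}, f ∉ spiderVerts y l q → G.Adj (q i 0) f →
      G.Adj (q i 0) u → u ≠ q i 1 → u = f := by
    intro i f u hf h1 h2 h3
    refine eq_of_degree_two (h.sail i).degree_zero.le (h.sail i).adj_zero h2 h1 h3 ?_
    rintro rfl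
    exact hf (h.mem_verts (h.sail i).pos)
  -- Arcs are right-unique: the flag is the only neighbour of the tip off the leg, and if it led to
  -- two legs there would be a four-cycle through `y`.
  obtain ⟨m, hm, c, hper, harc, hcinj⟩ := exists_periodic_of_transGen (by
    intro i j j' hj hj'
    rcases h.arc_cases hcrit hg hj with ⟨h1, -, f, hf, h2, h3⟩ | ⟨h1, h2, h3⟩ <;>
      rcases h.arc_cases hcrit hg hj' with ⟨h1', -, f', hf', h2', h3'⟩ | ⟨h1', h2', h3'⟩
    · obtain rfl := flag_unique hf h2 h2' (by
        rintro rfl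
        exact hf' (h.mem_verts (h.sail i).pos))
      by_contra hne
      refine not_fourCycle hg _ _ _ _ ?_ (fun he => hne (h.pen_inj hcrit hg he)) h3
        (h.adj_axis j).symm (h.adj_axis j') h3'.symm
      rintro rfl
      exact hf (Or.inl rfl)
    · omega
    · omega
    · exact h.shared_unique h2 h2' h3 h3') hi
  -- An arc from a leg of length 1 enters a leg of length at least 3, which no arc leaves. So every
  -- leg on the cycle has length 2.
  have hfl : ∀ t, l (c t) = 2 ∧ LowLeg l q (c t) ∧ ∃ f ∉ spiderVerts y l q,
      G.Adj (q (c t) 0) f ∧ G.Adj f (q (c (t + 1)) (l (c (t + 1)) - 1)) := by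
    intro t
    refine (h.arc_cases hcrit hg (harc t)).resolve_right ?_
    rintro ⟨h1, h2, h3⟩
    have h4 := h.three_le_of_shared hg h2 h3
    rcases h.arc_cases hcrit hg (harc (t + 1)) with ⟨h5, -⟩ | ⟨h5, -⟩ <;> omega
  have hl : ∀ t, l (c t) = 2 := fun t => (hfl t).1
  have hf : ∀ t, ∃ f ∉ spiderVerts y l q, G.Adj (q (c t) 0) f ∧ G.Adj f (q (c (t + 1)) 1) := by
    intro t
    obtain ⟨-, -, f, h1, h2, h3⟩ := hfl t
    rw [hl] at h3
    exact ⟨f, h1, h2, h3⟩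
  choose o ho hxo hoa using hf
  have hya : ∀ t, G.Adj y (q (c t) 1) := fun t => by
    have := h.adj_axis (c t)
    rwa [hl] at this
  have hax : ∀ t, G.Adj (q (c t) 1) (q (c t) 0) := fun t => (h.sail (c t)).adj_zero.symm
  have hxS : ∀ t, q (c t) 0 ∈ spiderVerts y l q := fun t => h.mem_verts (Nat.zero_le _)
  have haS : ∀ t, q (c t) 1 ∈ spiderVerts y l q := fun t => h.mem_verts (h.sail _).pos
  have hne1 : ∀ s t, o s ≠ q (c t) 1 := fun s t he => ho s (by rw [he]; exact haS t)
  refine containsWheel_of_cycle (y := y) (m := m) (a := fun t => q (c t) 1)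
    (x := fun t => q (c t) 0) (o := o) hm (not_triangle hg) (not_fourCycle hg)
    (fun t => by simp only [hper]) (fun t => by simp only [hper]) ?_ ?_ hya hax hxo hoa ?_ hne1 ?_
    ?_ ?_ (Or.inl (Or.inl rfl)) (fun t => Or.inl (haS t)) (fun t => Or.inl (hxS t)) ?_
  · intro t
    have := hxo (t + m)
    rw [hper] at this
    exact flag_unique (ho t) (hxo t) this (hne1 _ _)
  · intro s t hs ht he
    refine hcinj s t hs ht (h.pen_inj hcrit hg ?_)
    rw [hl, hl]
    exact he
  · intro t u hu
    by_cases h1 : u = q (c t) 1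
    · exact Or.inl h1
    · exact Or.inr (flag_unique (ho t) (hxo t) hu h1)
  · intro s t he
    exact ho s (by rw [he]; exact hxS t)
  · intro t he
    exact h.ne_axis (i := c t) (m := 0) (h.sail _).pos he.symm
  · intro t he
    exact ho t (Or.inl he.symm)
  · intro t
    refine Or.inr ⟨ho t, _, hxS t, _, haS (t + 1), ?_, (hxo t).symm, hoa t⟩
    intro he
    have h1 := hl t
    have h2 := hl (t + 1)
    have := h.inj hcrit hg (by omega) (by omega) he
    omega

end SailFamily

end Family

end GoodLabel

/-! ### From windmills to sail families -/

theorem mainTheorem2 {V : Type*} [Fintype V] (G : SimpleGraph V) [DecidableRel G.Adj]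
    (hcrit : GoodLabel.IsCritical G) (hgirth : 5 ≤ G.egirth)
    (k : ℕ) (y : V) (W : Set V) (hW : GoodLabel.IsWindmill G k y W) :
    ∃ S : Set V, S ⊆ GoodLabel.closureVerts G W ∧
      ∃ τ : S → Fin 3, GoodLabel.IsEvilWheel (G.induce S) τ ∨
        GoodLabel.IsAlmostEvilWheel (G.induce S) τ := by
  obtain ⟨hk, hdeg, x, P, hP, hinj, rfl⟩ := hW
  have h : GoodLabel.SailFamily G y k (fun i => (P i).length) (fun i => (P i).getVert) := by
    -- The degree bound is `max 4 k ≤ k + 1`, which holds because `k ≥ 3`.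
    refine ⟨fun i => (hP i).sailSeq, fun i => (P i).getVert_length, ?_, by omega, by omega⟩
    intro i j hij
    by_contra! hne
    simp only [SimpleGraph.Walk.getVert_zero] at hne
    refine hij (hinj ?_)
    change s(x i, (P i).getVert 1) = s(x j, (P j).getVert 1)
    exact congrArg₂ (fun a b => s(a, b)) hne.1 hne.2
  have hV : {v | ∃ i, v ∈ (P i).support} =
      GoodLabel.spiderVerts y (fun i => (P i).length) (fun i => (P i).getVert) := by
    ext v
    constructor
    · rintro ⟨i, hi⟩
      obtain ⟨n, rfl, hn⟩ := SimpleGraph.Walk.mem_support_iff_exists_getVert.1 hi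
      exact h.mem_verts hn
    · intro hv
      obtain ⟨i, m, -, rfl⟩ := h.exists_of_mem hv
      exact ⟨i, (P i).getVert_mem_support m⟩
  rw [hV]
  exact h.containsWheel hcrit hgirth
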